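/- Let $\lambda = (\lambda_1^{a_1}, \lambda_2^{a_2}, \ldots, \lambda_m^{a_m})$ be an integer partition written in weakly increasing order, where $m \ge 1$, $0 < \lambda_1 < \cdots < \lambda_m$ are integers, and $\lambda_i$ is repeated $a_i > 0$ times (for example $\lambda = (1^{a_1}, \ldots, m^{a_m})$). Put $n = a_1 + \cdots + a_m$ and let $\ell_1 \le \cdots \le \ell_n$ be the parts of $\lambda$ listed with multiplicity. The Gelfand–Tsetlin polytope $\mathrm{GT}_\lambda$ is the set of real triangular arrays $(x_{i,j})_{1 \le j \le i \le n}$ with $x_{i,i} = \ell_i$ for all $i$, and with $x_{i-1,j} \le x_{i,j}$ and $x_{i,j-1} \le x_{i,j}$ whenever both entries exist. Its 1-skeleton is the graph whose vertices and edges are the $0$- and $1$-dimensional faces of $\mathrm{GT}_\lambda$. Assume that $(a_1,\ldots,a_m)$ is neither $(1)$ nor $(1,1)$. Then the 1-skeleton of $\mathrm{GT}_\lambda$ is connected, and its graph diameter (the maximum over all pairs of vertices of the number of edges in a shortest path between them) is finite and equals $$2m - 2 - \delta_{1,a_1} - \delta_{1,a_m},$$ where $\delta_{x,y} = 1$ if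 $x = y$ and $\delta_{x,y} = 0$ otherwise. -/

import Mathlib

/-- The 1-skeleton of a polytope `P`: its vertices are the points `v` for which `{v}` is a face
of `P`, and two distinct vertices are joined by an edge iff they lie on a common
one-dimensional face of `P`. Faces are the sets of maximizers over `P` of linear functionals. -/
def oneSkeleton {E : Type*} [AddCommGroup E] [Module ℝ E] [TopologicalSpace E] (P : Set E) :
    SimpleGraph {v : E // IsExposed ℝ P {v}} where
  Adj u v := u ≠ v ∧ ∃ F : Set E, IsExposed ℝ P F ∧
    Module.finrank ℝ (vectorSpan ℝ F) = 1 ∧ (u : E) ∈ F ∧ (v : E) ∈ F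
  symm := ⟨fun _ _ ⟨hne, F, hF, hd, hu, hv⟩ => ⟨hne.symm, F, hF, hd, hv, hu⟩⟩
  loopless := ⟨fun _ h => h.1 rfl⟩

/-- The triangular index set: pairs (row, column) with column ≤ row. -/
abbrev TriangleIndex (n : ℕ) : Type := {p : Fin n × Fin n // p.2 ≤ p.1}

/-- The Gelfand–Tsetlin polytope of `lam`: triangular arrays with diagonal `lam` whose columns
(downwards) and rows (to the right) are weakly increasing. -/
def gtPolytope {n : ℕ} (lam : Fin n → ℕ) : Set (TriangleIndex n → ℝ) :=
  {x | (∀ i : Fin n, x ⟨(i, i), le_refl i⟩ = lam i) ∧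
    (∀ p q : TriangleIndex n, (q.1.1 : ℕ) = p.1.1 + 1 → q.1.2 = p.1.2 → x p ≤ x q) ∧
    (∀ p q : TriangleIndex n, q.1.1 = p.1.1 → (q.1.2 : ℕ) = p.1.2 + 1 → x p ≤ x q)}

/-- The sequence `(c 0, …, c 0, c 1, …, c 1, …)` in which `c i` is repeated `a i` times;
`finSigmaFinEquiv` enumerates the pairs `(i, k)` with `k < a i` lexicographically. -/
def blockSeq {m : ℕ} (c a : Fin m → ℕ) : Fin (∑ i, a i) → ℕ :=
  fun k => c (finSigmaFinEquiv.symm k).1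

/-! A point of the polytope is a vertex exactly when every connected piece of each of its level sets
reaches the diagonal; a piece that misses it could be shifted up and down. Two distinct vertices are
adjacent exactly when they differ on one connected set of cells on which each is constant
(`adj_of_isStep`, `isStep_of_adj`). The rest is combinatorics of such steps. Number the distinct
parts as levels 0, …, L with L = m - 1.

Upper bound: one step lowers all cells of a given level lying in columns with a smaller diagonal
entry (`IsVertexArray.exists_settle`). Treating levels L, …, 1 in this way turns every vertex into
the array whose entries equal the diagonal entry of their column, so distances are at most 2L. If
the smallest part is simple, level 1 can be left alone, because the two results then differ by a
single step in the first column. If the largest part is simple, its level sets are nested segments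
of the last row, and one step makes them agree. Each case saves one step.

Lower bound: the arrays ℓ ⌊(i + j) / 2⌋ and ℓ ⌈(i + j) / 2⌉ are far apart. Identifying the levels k,
…, k + d turns a path into a path for L - d and erases the steps that move cells among these levels;
if there are at least 2d of them, induction on L applies. In a minimal counterexample, cells pass
between two consecutive levels at one time only. Following a few cells near the first jump of the
diagonal then produces four moves among the levels 1, 2, 3, a contradiction
(`IsTransit.two_mul_le_changes`). A simple first or last part is merged with its neighbour at the
cost of one step. -/

namespace GelfandTsetlin

open Relation

variable {n : ℕ}

/-! ### Cells, arrays and steps -/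

/-- The diagonal cell in row `i`. -/
def diagCell (i : Fin n) : TriangleIndex n := ⟨(i, i), le_refl i⟩

/-- `q` is directly below or directly to the right of `p`. -/
def Covers (p q : TriangleIndex n) : Prop :=
  ((q.1.1 : ℕ) = p.1.1 + 1 ∧ q.1.2 = p.1.2) ∨ (q.1.1 = p.1.1 ∧ (q.1.2 : ℕ) = p.1.2 + 1)

/-- Two cells sharing a side. -/
def Nbr (p q : TriangleIndex n) : Prop := Covers p q ∨ Covers q p

/-- `p` and `q` are joined by a chain of neighbouring cells inside `S`. -/
def JoinedIn (S : Set (TriangleIndex n)) : TriangleIndex n → TriangleIndex n → Prop :=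
  ReflTransGen fun p q => Nbr p q ∧ p ∈ S ∧ q ∈ S

theorem Nbr.symm {p q : TriangleIndex n} (h : Nbr p q) : Nbr q p := Or.symm h

theorem JoinedIn.symm {S : Set (TriangleIndex n)} {p q : TriangleIndex n} (h : JoinedIn S p q) :
    JoinedIn S q p := by
  induction h with
  | refl => exact .refl
  | tail _ h ih => exact .head ⟨h.1.symm, h.2.2, h.2.1⟩ ih

theorem JoinedIn.trans {S : Set (TriangleIndex n)} {p q r : TriangleIndex n}
    (h : JoinedIn S p q) (h' : JoinedIn S q r) : JoinedIn S p r :=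
  ReflTransGen.trans h h'

theorem JoinedIn.mono {S T : Set (TriangleIndex n)} (hST : S ⊆ T) {p q : TriangleIndex n}
    (h : JoinedIn S p q) : JoinedIn T p q := by
  induction h with
  | refl => exact .refl
  | tail _ h ih => exact .tail ih ⟨h.1, hST h.2.1, hST h.2.2⟩

theorem JoinedIn.mem {S : Set (TriangleIndex n)} {p q : TriangleIndex n} (h : JoinedIn S p q)
    (hp : p ∈ S) : q ∈ S := by
  induction h with
  | refl => exact hp
  | tail _ h _ => exact h.2.2

theorem JoinedIn.eq_of_forall_nbr {α : Type*} {S : Set (TriangleIndex n)} {p q : TriangleIndex n}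
    (h : JoinedIn S p q) (y : TriangleIndex n → α)
    (hy : ∀ r s, Covers r s → r ∈ S → s ∈ S → y r = y s) : y p = y q := by
  induction h with
  | refl => rfl
  | tail _ h ih =>
    rcases h.1 with h1 | h1
    · exact ih.trans (hy _ _ h1 h.2.1 h.2.2)
    · exact ih.trans (hy _ _ h1 h.2.2 h.2.1).symm

/-- Triangular arrays with diagonal `ℓ`, increasing along rows and columns. -/
structure IsArray {α : Type*} [LE α] (ℓ : Fin n → α) (x : TriangleIndex n → α) : Prop where
  diag : ∀ i, x (diagCell i) = ℓ i
  mono : ∀ p q, Covers p q → x p ≤ x q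

/-- Arrays in which every level set is joined to the diagonal. -/
structure IsVertexArray {α : Type*} [LE α] (ℓ : Fin n → α) (x : TriangleIndex n → α) : Prop
    extends IsArray ℓ x where
  joined : ∀ p, ∃ i, JoinedIn {q | x q = x p} p (diagCell i)

/-- The cells where `x` and `y` differ are connected, and both `x` and `y` are constant there. -/
def IsStep {α : Type*} (x y : TriangleIndex n → α) : Prop :=
  (∃ a b, ∀ p, x p ≠ y p → x p = a ∧ y p = b) ∧
    ∀ p q, x p ≠ y p → x q ≠ y q → JoinedIn {r | x r ≠ y r} p q

/-! ### Vertices and edges of the polytope -/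

theorem mem_gtPolytope_iff {lam : Fin n → ℕ} {x : TriangleIndex n → ℝ} :
    x ∈ gtPolytope lam ↔ IsArray (fun i => (lam i : ℝ)) x := by
  constructor
  · rintro ⟨h1, h2, h3⟩
    refine ⟨h1, ?_⟩
    rintro p q (⟨h, h'⟩ | ⟨h, h'⟩)
    · exact h2 p q h h'
    · exact h3 p q h h'
  · rintro ⟨h1, h2⟩
    exact ⟨h1, fun p q h h' => h2 p q (.inl ⟨h, h'⟩), fun p q h h' => h2 p q (.inr ⟨h, h'⟩)⟩

/-- Turning some of the defining inequalities into equalities gives a face. -/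
theorem isExposed_tight (lam : Fin n → ℕ) (R : TriangleIndex n → TriangleIndex n → Prop) :
    IsExposed ℝ (gtPolytope lam)
      {y | y ∈ gtPolytope lam ∧ ∀ p q, Covers p q → R p q → y p = y q} := by
  classical
  rintro ⟨z, hz, hzR⟩
  -- Every summand is nonpositive on the polytope, and `z` attains the value 0, so the maximizers
  -- are the points where all chosen inequalities are tight.
  let l : StrongDual ℝ (TriangleIndex n → ℝ) :=
    ∑ p, ∑ q, if Covers p q ∧ R p q then
      ContinuousLinearMap.proj (R := ℝ) (φ := fun _ : TriangleIndex n => ℝ) p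
        - ContinuousLinearMap.proj (R := ℝ) (φ := fun _ : TriangleIndex n => ℝ) q else 0
  have hl : ∀ y, l y = ∑ p, ∑ q, if Covers p q ∧ R p q then y p - y q else 0 := by
    intro y
    simp only [l, sum_apply]
    refine Finset.sum_congr rfl fun p _ => Finset.sum_congr rfl fun q _ => ?_
    split_ifs <;> simp
  have hterm : ∀ y ∈ gtPolytope lam, ∀ p q,
      (if Covers p q ∧ R p q then y p - y q else 0) ≤ 0 := by
    intro y hy p q
    split_ifs with h
    · exact sub_nonpos.2 ((mem_gtPolytope_iff.1 hy).mono p q h.1)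
    · exact le_rfl
  have hle : ∀ y ∈ gtPolytope lam, l y ≤ 0 := fun y hy => by
    rw [hl]
    exact Finset.sum_nonpos fun p _ => Finset.sum_nonpos fun q _ => hterm y hy p q
  have hzero : ∀ y, (∀ p q, Covers p q → R p q → y p = y q) → l y = 0 := fun y hy => by
    rw [hl]
    refine Finset.sum_eq_zero fun p _ => Finset.sum_eq_zero fun q _ => ?_
    split_ifs with h
    · exact sub_eq_zero.2 (hy p q h.1 h.2)
    · rfl
  refine ⟨l, Set.ext fun y => ⟨fun ⟨hy, hyR⟩ => ⟨hy, fun y' hy' => ?_⟩, fun ⟨hy, hmax⟩ => ⟨hy, ?_⟩⟩⟩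
  · rw [hzero y hyR]
    exact hle y' hy'
  · intro p q hpq hR
    have h0 : l y = 0 := le_antisymm (hle y hy) ((hzero z hzR).symm.le.trans (hmax z hz))
    rw [hl] at h0
    have h1 := (Finset.sum_eq_zero_iff_of_nonpos fun p _ =>
      Finset.sum_nonpos fun q _ => hterm y hy p q).1 h0 p (Finset.mem_univ _)
    have h2 := (Finset.sum_eq_zero_iff_of_nonpos fun q _ => hterm y hy p q).1 h1 q
      (Finset.mem_univ _)
    rw [if_pos ⟨hpq, hR⟩] at h2
    exact sub_eq_zero.1 h2

/-- A set of cells that avoids the diagonal and is closed under equal-valued neighbours may be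
shifted within every face. -/
theorem exists_add_indicator_mem {lam : Fin n → ℕ} {F : Set (TriangleIndex n → ℝ)}
    (hF : IsExposed ℝ (gtPolytope lam) F) {z : TriangleIndex n → ℝ} (hz : z ∈ F)
    {C : Set (TriangleIndex n)} (hdiag : ∀ i, diagCell i ∉ C)
    (hC : ∀ p q, p ∈ C → Nbr p q → z p = z q → q ∈ C) :
    ∃ ε : ℝ, 0 < ε ∧ z + ε • C.indicator 1 ∈ F := by
  classical
  obtain ⟨l, hl⟩ := hF ⟨z, hz⟩
  rw [hl] at hz ⊢
  obtain ⟨hzP, hmax⟩ := hz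
  have hzA := mem_gtPolytope_iff.1 hzP
  -- Smaller than every positive difference of entries, so a shift by `±ε` cannot reverse a strict
  -- inequality.
  obtain ⟨ε, hε, hgap⟩ : ∃ ε : ℝ, 0 < ε ∧ ∀ p q : TriangleIndex n, z p < z q → ε < z q - z p := by
    have : ∀ᶠ ε : ℝ in nhdsWithin 0 (Set.Ioi 0),
        ∀ p q : TriangleIndex n, z p < z q → ε < z q - z p := by
      refine Filter.eventually_all.2 fun p => Filter.eventually_all.2 fun q => ?_
      by_cases h : z p < z q
      · filter_upwards [nhdsWithin_le_nhds (Iio_mem_nhds (sub_pos.2 h))] with ε hε _ using hε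
      · exact Filter.Eventually.of_forall fun _ h' => absurd h' h
    obtain ⟨ε, h1, h2⟩ := (this.and self_mem_nhdsWithin).exists
    exact ⟨ε, h2, h1⟩
  have key : ∀ σ : ℝ, |σ| ≤ 1 → z + (σ * ε) • C.indicator 1 ∈ gtPolytope lam := by
    intro σ hσ
    obtain ⟨hσ1, hσ2⟩ := abs_le.1 hσ
    refine mem_gtPolytope_iff.2 ⟨fun i => ?_, fun p q hpq => ?_⟩
    · simp [Set.indicator_of_notMem (hdiag i), hzA.diag i]
    · have hle := hzA.mono p q hpq
      by_cases hp : p ∈ C <;> by_cases hq : q ∈ C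
      · simpa [hp, hq] using hle
      · have hlt : z p < z q := lt_of_le_of_ne hle fun h => hq (hC p q hp (.inl hpq) h)
        have := hgap p q hlt
        simp only [Pi.add_apply, Pi.smul_apply, Set.indicator_of_mem hp,
          Set.indicator_of_notMem hq, Pi.one_apply, smul_eq_mul, mul_one, mul_zero, add_zero]
        nlinarith
      · have hlt : z p < z q := lt_of_le_of_ne hle fun h => hp (hC q p hq (.inr hpq) h.symm)
        have := hgap p q hlt
        simp only [Pi.add_apply, Pi.smul_apply, Set.indicator_of_mem hq,
          Set.indicator_of_notMem hp, Pi.one_apply, smul_eq_mul, mul_one, mul_zero, add_zero]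
        nlinarith
      · simpa [hp, hq] using hle
  have hplus := key 1 (by simp)
  have hminus := key (-1) (by simp)
  rw [one_mul] at hplus
  refine ⟨ε, hε, hplus, fun y hy => ?_⟩
  -- The shift by `-ε` stays in the polytope, so `l` is nonnegative on the indicator; hence the
  -- shift by `ε` maximizes `l` as well.
  have h1 := hmax _ hminus
  have h2 := hmax y hy
  simp only [map_add, map_smul, smul_eq_mul] at h1 ⊢
  linarith

/-- A component of a level set that misses the diagonal could be shifted, giving a second point of
the face `{v}`. -/
theorem isVertexArray_of_isExposed {lam : Fin n → ℕ} {v : TriangleIndex n → ℝ}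
    (hv : IsExposed ℝ (gtPolytope lam) {v}) : IsVertexArray (fun i => (lam i : ℝ)) v := by
  have hvP : v ∈ gtPolytope lam := hv.subset rfl
  refine ⟨mem_gtPolytope_iff.1 hvP, fun p => ?_⟩
  by_contra! hcon
  obtain ⟨ε, hε, hmem⟩ := exists_add_indicator_mem hv (z := v) rfl
    (C := {q | JoinedIn {q | v q = v p} p q}) hcon (by
      intro q r hq hqr heq
      have hqS : v q = v p := JoinedIn.mem hq rfl
      exact ReflTransGen.tail hq ⟨hqr, hqS, heq.symm.trans hqS⟩)
  have := congrFun (Set.mem_singleton_iff.1 hmem) p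
  rw [Pi.add_apply, Pi.smul_apply, Set.indicator_of_mem (by exact ReflTransGen.refl)] at this
  simp at this
  exact hε.ne' this

/-- The equalities tight at `v` chain every entry to a diagonal entry, whose value is prescribed. -/
theorem isExposed_of_isVertexArray {lam : Fin n → ℕ} {v : TriangleIndex n → ℝ}
    (hv : IsVertexArray (fun i => (lam i : ℝ)) v) : IsExposed ℝ (gtPolytope lam) {v} := by
  convert isExposed_tight lam (fun p q => v p = v q) using 1
  refine Set.ext fun y => ⟨?_, fun ⟨hy, hR⟩ => funext fun p => ?_⟩
  · rintro rfl
    exact ⟨mem_gtPolytope_iff.2 hv.toIsArray, fun _ _ _ h => h⟩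
  · obtain ⟨i, hi⟩ := hv.joined p
    have h1 := hi.eq_of_forall_nbr y fun r s hrs hr hs => hR r s hrs (Eq.trans hr hs.symm)
    have h2 : v (diagCell i) = v p := hi.mem rfl
    rw [h1, (mem_gtPolytope_iff.1 hy).diag, ← h2, hv.diag]

/-- Away from the cells where two vertex arrays differ by a step, common level sets reach the
diagonal. -/
theorem IsStep.joined_compl {α : Type*} [LE α] {ℓ : Fin n → α} {x y : TriangleIndex n → α}
    (hx : IsVertexArray ℓ x) (hy : IsVertexArray ℓ y) (hs : IsStep x y) {p : TriangleIndex n}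
    (hp : x p = y p) : ∃ i, JoinedIn {q | x q = x p ∧ y q = y p} p (diagCell i) := by
  obtain ⟨⟨a, b, hab⟩, -⟩ := hs
  -- Differing cells have `x`-value `a`. Hence the `a`-level set of `y` contains none of them, and
  -- neither does any other level set of `x`.
  by_cases h : x p = a
  · obtain ⟨i, hi⟩ := hy.joined p
    refine ⟨i, hi.mono fun q (hq : y q = y p) => ?_⟩
    refine ⟨?_, hq⟩
    by_contra hne
    have hxy : x q ≠ y q := fun h' => hne (h'.trans (hq.trans hp.symm))
    obtain ⟨h1, -⟩ := hab q hxy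
    exact hne (h1.trans h.symm)
  · obtain ⟨i, hi⟩ := hx.joined p
    refine ⟨i, hi.mono fun q (hq : x q = x p) => ?_⟩
    refine ⟨hq, ?_⟩
    by_contra hne
    have hxy : x q ≠ y q := fun h' => hne (h'.symm.trans (hq.trans hp))
    exact h (hq.symm.trans (hab q hxy).1)

/-- In the face of inequalities tight at both vertices, entries where the vertices agree are pinned
to the diagonal and all others share one free value. -/
theorem adj_of_isStep {lam : Fin n → ℕ}
    {u v : {v : TriangleIndex n → ℝ // IsExposed ℝ (gtPolytope lam) {v}}} (huv : u ≠ v)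
    (hs : IsStep u.1 v.1) : (oneSkeleton (gtPolytope lam)).Adj u v := by
  obtain ⟨u, hu⟩ := u
  obtain ⟨v, hv⟩ := v
  have hu' := isVertexArray_of_isExposed hu
  have hv' := isVertexArray_of_isExposed hv
  have hne : u ≠ v := fun h => huv (Subtype.ext h)
  refine ⟨huv, _, isExposed_tight lam (fun p q => u p = u q ∧ v p = v q), ?_,
    ⟨mem_gtPolytope_iff.2 hu'.toIsArray, fun _ _ _ h => h.1⟩,
    ⟨mem_gtPolytope_iff.2 hv'.toIsArray, fun _ _ _ h => h.2⟩⟩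
  set F := {y | y ∈ gtPolytope lam ∧ ∀ p q, Covers p q → u p = u q ∧ v p = v q → y p = y q}
  have huF : u ∈ F := ⟨mem_gtPolytope_iff.2 hu'.toIsArray, fun _ _ _ h => h.1⟩
  have hvF : v ∈ F := ⟨mem_gtPolytope_iff.2 hv'.toIsArray, fun _ _ _ h => h.2⟩
  obtain ⟨p₀, hp₀⟩ : ∃ p, u p ≠ v p := Function.ne_iff.1 hne
  obtain ⟨⟨a, b, hab⟩, hconn⟩ := id hs
  have hspan : vectorSpan ℝ F = Submodule.span ℝ {v - u} := by
    refine le_antisymm (Submodule.span_le.2 ?_) (Submodule.span_le.2 ?_)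
    · rintro _ ⟨y, hy, y', hy', rfl⟩
      refine Submodule.mem_span_singleton.2 ⟨(y p₀ - y' p₀) / (v p₀ - u p₀), funext fun p => ?_⟩
      have hd : v p₀ - u p₀ ≠ 0 := sub_ne_zero.2 hp₀.symm
      by_cases hp : u p = v p
      · obtain ⟨i, hi⟩ := hs.joined_compl hu' hv' hp
        have hFi : ∀ y ∈ F, y p = lam i := fun y hy => by
          rw [hi.eq_of_forall_nbr y fun r s hrs hr hs =>
            hy.2 r s hrs ⟨hr.1.trans hs.1.symm, hr.2.trans hs.2.symm⟩]
          exact (mem_gtPolytope_iff.1 hy.1).diag i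
        simp [hp, hFi y hy, hFi y' hy']
      · have hFp : ∀ y ∈ F, y p = y p₀ := fun y hy =>
          (hconn p p₀ hp hp₀).eq_of_forall_nbr y fun r s hrs hr hs =>
            hy.2 r s hrs ⟨(hab r hr).1.trans (hab s hs).1.symm,
              (hab r hr).2.trans (hab s hs).2.symm⟩
        simp only [Pi.smul_apply, Pi.sub_apply, smul_eq_mul, vsub_eq_sub, hFp y hy, hFp y' hy',
          hFp u huF, hFp v hvF]
        field_simp
    · rintro _ rfl
      exact vsub_mem_vectorSpan ℝ hvF huF
  rw [hspan]
  exact finrank_span_singleton (sub_ne_zero.2 hne.symm)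

/-- At the midpoint of the two vertices an inequality is tight only if it is tight at both. A
component of a common level set on which they differ can therefore be shifted within the face, and
dimension one makes this shift proportional to `v - u`. -/
theorem isStep_of_adj {lam : Fin n → ℕ}
    {u v : {v : TriangleIndex n → ℝ // IsExposed ℝ (gtPolytope lam) {v}}}
    (h : (oneSkeleton (gtPolytope lam)).Adj u v) : IsStep u.1 v.1 := by
  obtain ⟨u, hu⟩ := u
  obtain ⟨v, hv⟩ := v
  obtain ⟨hne, F, hF, hdim, huF, hvF⟩ := h
  simp only at huF hvF ⊢
  have hu' := (isVertexArray_of_isExposed hu).toIsArray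
  have hv' := (isVertexArray_of_isExposed hv).toIsArray
  have hne' : v - u ≠ 0 := sub_ne_zero.2 fun h => hne (Subtype.ext h.symm)
  let z : TriangleIndex n → ℝ := (2⁻¹ : ℝ) • (u + v)
  have hz : ∀ p, z p = 2⁻¹ * (u p + v p) := fun _ => rfl
  have hzF : z ∈ F := by
    obtain ⟨l, hl⟩ := hF ⟨u, huF⟩
    rw [hl] at huF hvF ⊢
    refine ⟨mem_gtPolytope_iff.2 ⟨fun i => ?_, fun p q hpq => ?_⟩, fun y hy => ?_⟩
    · rw [hz, hu'.diag, hv'.diag]; ring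
    · rw [hz, hz]
      linarith [hu'.mono p q hpq, hv'.mono p q hpq]
    · simp only [z, map_smul, map_add, smul_eq_mul]
      linarith [huF.2 y hy, hvF.2 y hy]
  have hd : v - u ∈ vectorSpan ℝ F := vsub_mem_vectorSpan ℝ hvF huF
  have key : ∀ p q, u p ≠ v p → u q ≠ v q → JoinedIn {r | u r = u p ∧ v r = v p} p q := by
    intro p q hp hq
    let C : Set (TriangleIndex n) := {q | JoinedIn {r | u r = u p ∧ v r = v p} p q}
    obtain ⟨ε, hε, hmem⟩ := exists_add_indicator_mem hF hzF (C := C)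
      (by
        intro i hi
        obtain ⟨h1, h2⟩ := JoinedIn.mem hi ⟨rfl, rfl⟩
        rw [hu'.diag] at h1
        rw [hv'.diag] at h2
        exact hp (h1.symm.trans h2))
      (by
        intro r s hr hrs hrsz
        have hrS := JoinedIn.mem hr ⟨rfl, rfl⟩
        have : u r = u s ∧ v r = v s := by
          rw [hz, hz] at hrsz
          rcases hrs with hrs | hrs
          · have h1 := hu'.mono _ _ hrs
            have h2 := hv'.mono _ _ hrs
            constructor <;> linarith
          · have h1 := hu'.mono _ _ hrs
            have h2 := hv'.mono _ _ hrs
            constructor <;> linarith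
        exact ReflTransGen.tail hr ⟨hrs, hrS, this.1.symm.trans hrS.1, this.2.symm.trans hrS.2⟩)
    have hind : ε • C.indicator (1 : TriangleIndex n → ℝ) ∈ vectorSpan ℝ F := by
      have := vsub_mem_vectorSpan ℝ hmem hzF
      rwa [vsub_eq_sub, add_sub_cancel_left] at this
    obtain ⟨t, ht⟩ := (finrank_eq_one_iff_of_nonzero' (⟨v - u, hd⟩ : vectorSpan ℝ F)
      (fun h => hne' (congrArg Subtype.val h))).1 hdim ⟨_, hind⟩
    have ht' : t • (v - u) = ε • C.indicator (1 : TriangleIndex n → ℝ) := congrArg Subtype.val ht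
    have hpC : p ∈ C := ReflTransGen.refl
    have h1 := congrFun ht' p
    have h2 := congrFun ht' q
    simp only [Pi.smul_apply, Pi.sub_apply, smul_eq_mul, Set.indicator_of_mem hpC, Pi.one_apply,
      mul_one] at h1
    by_contra hqC
    simp only [Pi.smul_apply, Pi.sub_apply, smul_eq_mul,
      Set.indicator_of_notMem (show q ∉ C from hqC), mul_zero, mul_eq_zero] at h2
    rcases h2 with h2 | h2
    · rw [h2, zero_mul] at h1
      exact hε.ne h1
    · exact hq (sub_eq_zero.1 h2).symm
  obtain ⟨p₀, hp₀⟩ : ∃ p, u p ≠ v p := by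
    by_contra! hcon
    exact hne (Subtype.ext (funext hcon))
  refine ⟨⟨u p₀, v p₀, fun p hp => (key p₀ p hp₀ hp).mem ⟨rfl, rfl⟩⟩, fun p q hp hq =>
    (key p q hp hq).mono fun r hr => ?_⟩
  show u r ≠ v r
  rw [hr.1, hr.2]
  exact hp

/-! ### Monotonicity and relabelling of values -/

/-- The cell in row `i` and column `j`. -/
def cell (i j : ℕ) (hi : i < n) (hj : j ≤ i) : TriangleIndex n :=
  ⟨(⟨i, hi⟩, ⟨j, hj.trans_lt hi⟩), hj⟩

theorem TriangleIndex.ext_val {p q : TriangleIndex n} (h1 : (p.1.1 : ℕ) = q.1.1)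
    (h2 : (p.1.2 : ℕ) = q.1.2) : p = q :=
  Subtype.ext (Prod.ext (Fin.ext h1) (Fin.ext h2))

theorem IsArray.le_of_le {α : Type*} [Preorder α] {ℓ : Fin n → α} {x : TriangleIndex n → α}
    (hx : IsArray ℓ x) {p q : TriangleIndex n} (h1 : (p.1.1 : ℕ) ≤ q.1.1)
    (h2 : (p.1.2 : ℕ) ≤ q.1.2) : x p ≤ x q := by
  have hq : (q.1.2 : ℕ) ≤ q.1.1 := q.2
  have hp : (p.1.2 : ℕ) ≤ p.1.1 := p.2
  have hqn := q.1.1.2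
  -- Going down the column of `p` first and then right along the row of `q` stays inside the
  -- triangle.
  have down : ∀ d (hd : (p.1.1 : ℕ) + d < n),
      x p ≤ x (cell (p.1.1 + d) p.1.2 hd (by omega)) := by
    intro d
    induction d with
    | zero => exact fun _ => le_rfl
    | succ d ih => exact fun hd => (ih (by omega)).trans (hx.mono _ _ (.inl ⟨rfl, rfl⟩))
  have right : ∀ d (hd : (p.1.2 : ℕ) + d ≤ q.1.1),
      x (cell q.1.1 p.1.2 hqn (by omega)) ≤ x (cell q.1.1 (p.1.2 + d) hqn hd) := by
    intro d
    induction d with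
    | zero => exact fun _ => le_rfl
    | succ d ih => exact fun hd => (ih (by omega)).trans (hx.mono _ _ (.inr ⟨rfl, rfl⟩))
  have e1 := down (q.1.1 - p.1.1) (by omega)
  have e2 := right (q.1.2 - p.1.2) (by omega)
  have c1 : cell (p.1.1 + (q.1.1 - p.1.1)) p.1.2 (by omega) (by omega)
      = cell (n := n) q.1.1 p.1.2 hqn (by omega) :=
    TriangleIndex.ext_val (by simp [cell]; omega) (by simp [cell])
  have c2 : cell (n := n) q.1.1 (p.1.2 + (q.1.2 - p.1.2)) hqn (by omega) = q :=
    TriangleIndex.ext_val (by simp [cell]) (by simp [cell]; omega)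
  rw [c1] at e1
  rw [c2] at e2
  exact e1.trans e2

theorem IsArray.le_diag_row {α : Type*} [Preorder α] {ℓ : Fin n → α} {x : TriangleIndex n → α}
    (hx : IsArray ℓ x) (p : TriangleIndex n) : x p ≤ ℓ p.1.1 := by
  rw [← hx.diag]
  exact hx.le_of_le le_rfl p.2

theorem IsArray.diag_col_le {α : Type*} [Preorder α] {ℓ : Fin n → α} {x : TriangleIndex n → α}
    (hx : IsArray ℓ x) (p : TriangleIndex n) : ℓ p.1.2 ≤ x p := by
  rw [← hx.diag]
  exact hx.le_of_le p.2 le_rfl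

theorem IsVertexArray.comp {α β : Type*} [Preorder α] [Preorder β] {ℓ : Fin n → α}
    {x : TriangleIndex n → α} (hx : IsVertexArray ℓ x) {f : α → β} (hf : Monotone f) :
    IsVertexArray (f ∘ ℓ) (f ∘ x) where
  diag i := congrArg f (hx.diag i)
  mono p q h := hf (hx.mono p q h)
  joined p := (hx.joined p).imp fun _ hi => hi.mono fun _ hq => congrArg f hq

theorem IsStep.comp {α β : Type*} {x y : TriangleIndex n → α} (h : IsStep x y) (f : α → β) :
    IsStep (f ∘ x) (f ∘ y) := by
  obtain ⟨⟨a, b, hab⟩, hconn⟩ := h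
  have hne : ∀ p, (f ∘ x) p ≠ (f ∘ y) p → x p ≠ y p := fun p hp h => hp (congrArg f h)
  refine ⟨⟨f a, f b, fun p hp => ?_⟩, fun p q hp hq => ?_⟩
  · obtain ⟨h1, h2⟩ := hab p (hne p hp)
    exact ⟨congrArg f h1, congrArg f h2⟩
  · refine (hconn p q (hne p hp) (hne q hq)).mono fun r hr => ?_
    obtain ⟨h1, h2⟩ := hab r hr
    obtain ⟨h3, h4⟩ := hab p (hne p hp)
    show f (x r) ≠ f (y r)
    rw [h1, h2, ← h3, ← h4]
    exact hp

theorem IsStep.exists_nbr {α : Type*} {x y : TriangleIndex n → α} (h : IsStep x y)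
    {p q : TriangleIndex n} (hpq : p ≠ q) (hp : x p ≠ y p) (hq : x q ≠ y q) :
    ∃ z, Nbr p z ∧ x z ≠ y z := by
  rcases ReflTransGen.cases_head (h.2 p q hp hq) with h | ⟨z, hz, -⟩
  · exact absurd h hpq
  · exact ⟨z, hz.1, hz.2.2⟩

/-! ### Moves, merging of levels and transits -/

/-- Some cell changes from `a` to `b` between times `t` and `t + 1`. -/
def HasMove {α : Type*} (X : ℕ → TriangleIndex n → α) (t : ℕ) (a b : α) : Prop :=
  ∃ p, X t p = a ∧ X (t + 1) p = b

theorem IsStep.hasMove_unique {α : Type*} {X : ℕ → TriangleIndex n → α} {t : ℕ}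
    (h : IsStep (X t) (X (t + 1))) {a b a' b' : α} (hab : a ≠ b) (hab' : a' ≠ b')
    (h1 : HasMove X t a b) (h2 : HasMove X t a' b') : a = a' ∧ b = b' := by
  obtain ⟨⟨c, d, hcd⟩, -⟩ := h
  obtain ⟨p, rfl, rfl⟩ := h1
  obtain ⟨q, rfl, rfl⟩ := h2
  have e1 := hcd p hab
  have e2 := hcd q hab'
  exact ⟨e1.1.trans e2.1.symm, e1.2.trans e2.2.symm⟩

open Classical in
/-- The number of times before `N` at which `X` changes. -/
noncomputable def changes {α : Type*} (X : ℕ → TriangleIndex n → α) (N : ℕ) : ℕ :=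
  ((Finset.range N).filter fun t => X t ≠ X (t + 1)).card

theorem changes_le {α : Type*} (X : ℕ → TriangleIndex n → α) (N : ℕ) : changes X N ≤ N := by
  classical
  exact (Finset.card_filter_le _ _).trans (Finset.card_range N).le

/-- A step makes only one kind of move, so a step between identified values becomes stationary under
`f` and is not among the surviving changes. -/
theorem card_add_changes_comp_le {α β : Type*} {X : ℕ → TriangleIndex n → α} {N : ℕ}
    (hS : ∀ t < N, IsStep (X t) (X (t + 1))) (f : α → β) (T : Finset ℕ)
    (hT : ∀ t ∈ T, t < N ∧ ∃ a b, a ≠ b ∧ f a = f b ∧ HasMove X t a b) :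
    T.card + changes (fun t => f ∘ X t) N ≤ changes X N := by
  classical
  unfold changes
  rw [← Finset.card_union_of_disjoint]
  · refine Finset.card_le_card fun t ht => ?_
    simp only [Finset.mem_union, Finset.mem_filter, Finset.mem_range] at ht ⊢
    rcases ht with ht | ht
    · obtain ⟨h1, a, b, hab, -, p, hp1, hp2⟩ := hT t ht
      refine ⟨h1, fun h => hab ?_⟩
      rw [← hp1, ← hp2, h]
    · exact ⟨ht.1, fun h => ht.2 (by rw [h])⟩
  · refine Finset.disjoint_left.2 fun t ht ht' => ?_
    simp only [Finset.mem_filter, Finset.mem_range] at ht'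
    obtain ⟨h1, a, b, hab, hf, hmove⟩ := hT t ht
    refine ht'.2 (funext fun q => ?_)
    by_cases hq : X t q = X (t + 1) q
    · exact congrArg f hq
    · obtain ⟨e1, e2⟩ := (hS t h1).hasMove_unique hab hq hmove ⟨q, rfl, rfl⟩
      show f (X t q) = f (X (t + 1) q)
      rw [← e1, ← e2, hf]

/-- The monotone map that identifies the numbers `k, …, k + d` and closes the gap. -/
def merge (k d t : ℕ) : ℕ := min t k + (t - (k + d))

theorem merge_monotone (k d : ℕ) : Monotone (merge k d) := fun a b h => by
  unfold merge; omega

/-- Weakly increasing sequences without gaps from `0` at `0` to `L` at `n - 1`. -/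
structure IsLevelSeq (n L : ℕ) (ℓ : ℕ → ℕ) : Prop where
  mono : Monotone ℓ
  zero : ℓ 0 = 0
  succ_le : ∀ i, ℓ (i + 1) ≤ ℓ i + 1
  last : ℓ (n - 1) = L

theorem IsLevelSeq.merge {n L k d : ℕ} {ℓ : ℕ → ℕ} (h : IsLevelSeq n L ℓ) (hkd : k + d ≤ L) :
    IsLevelSeq n (L - d) (merge k d ∘ ℓ) where
  mono := (merge_monotone k d).comp h.mono
  zero := by simp [GelfandTsetlin.merge, h.zero]
  succ_le i := by
    have := h.succ_le i
    have := h.mono (Nat.le_succ i)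
    simp only [GelfandTsetlin.merge, Function.comp_apply]
    omega
  last := by
    simp only [GelfandTsetlin.merge, Function.comp_apply, h.last]
    omega

theorem IsLevelSeq.exists_jump {n L k : ℕ} {ℓ : ℕ → ℕ} (h : IsLevelSeq n L ℓ) (hk : k < L) :
    ∃ s, s + 1 < n ∧ ℓ s = k ∧ ℓ (s + 1) = k + 1 := by
  have hex : ∃ i, k < ℓ i := ⟨n - 1, by rw [h.last]; exact hk⟩
  classical
  have h1 := Nat.find_spec hex
  have h2 := Nat.find_min' hex (m := n - 1) (by rw [h.last]; exact hk)
  rcases hi : Nat.find hex with _ | s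
  · rw [hi, h.zero] at h1
    omega
  · rw [hi] at h1 h2
    have h3 : ¬ k < ℓ s := Nat.find_min hex (by omega)
    have := h.succ_le s
    exact ⟨s, by omega, by omega, by omega⟩

/-- A sequence of vertex arrays, changing by steps, from the array `ℓ ⌊(i + j) / 2⌋` to the array
`ℓ ⌈(i + j) / 2⌉`. -/
structure IsTransit (n : ℕ) (ℓ : ℕ → ℕ) (N : ℕ) (X : ℕ → TriangleIndex n → ℕ) : Prop where
  vert : ∀ t ≤ N, IsVertexArray (fun i : Fin n => ℓ i) (X t)
  step : ∀ t < N, IsStep (X t) (X (t + 1))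
  init : ∀ p, X 0 p = ℓ ((p.1.1 + p.1.2) / 2)
  final : ∀ p, X N p = ℓ ((p.1.1 + p.1.2 + 1) / 2)

theorem IsTransit.comp {ℓ : ℕ → ℕ} {N : ℕ} {X : ℕ → TriangleIndex n → ℕ} (h : IsTransit n ℓ N X)
    {f : ℕ → ℕ} (hf : Monotone f) : IsTransit n (f ∘ ℓ) N (fun t => f ∘ X t) where
  vert t ht := (h.vert t ht).comp hf
  step t ht := (h.step t ht).comp f
  init p := congrArg f (h.init p)
  final p := congrArg f (h.final p)

theorem exists_entry {α : Type*} {g : ℕ → α} {a b : ℕ} {c : α} (hab : a ≤ b) (ha : g a ≠ c)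
    (hb : g b = c) : ∃ t, a ≤ t ∧ t < b ∧ g t ≠ c ∧ g (t + 1) = c := by
  induction b, hab using Nat.le_induction with
  | base => exact absurd hb ha
  | succ b hab ih =>
    by_cases h : g b = c
    · obtain ⟨t, h1, h2, h3⟩ := ih h
      exact ⟨t, h1, by omega, h3⟩
    · exact ⟨b, hab, by omega, h, hb⟩

theorem exists_exit {α : Type*} {g : ℕ → α} {a b : ℕ} {c : α} (hab : a ≤ b) (ha : g a = c)
    (hb : g b ≠ c) : ∃ t, a ≤ t ∧ t < b ∧ g t = c ∧ g (t + 1) ≠ c := by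
  induction b, hab using Nat.le_induction with
  | base => exact absurd ha hb
  | succ b hab ih =>
    by_cases h : g b = c
    · exact ⟨b, hab, by omega, h, hb⟩
    · obtain ⟨t, h1, h2, h3⟩ := ih h
      exact ⟨t, h1, by omega, h3⟩

/-- A jump of `ℓ` forces a move between the two consecutive levels, at the cell next to it. -/
theorem IsTransit.exists_move {ℓ : ℕ → ℕ} {N : ℕ} {X : ℕ → TriangleIndex n → ℕ}
    (h : IsTransit n ℓ N X) {s k : ℕ} (hs : s + 1 < n) (h1 : ℓ s = k) (h2 : ℓ (s + 1) = k + 1) :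
    ∃ t < N, X t (cell (s + 1) s hs (by omega)) = k ∧
      X (t + 1) (cell (s + 1) s hs (by omega)) = k + 1 := by
  set p : TriangleIndex n := cell (s + 1) s hs (by omega)
  have hp1 : (p.1.1 : ℕ) = s + 1 := rfl
  have hp2 : (p.1.2 : ℕ) = s := rfl
  have i0 : X 0 p = k := by
    rw [h.init, hp1, hp2, ← h1]; congr 1; omega
  have i1 : X N p = k + 1 := by
    rw [h.final, hp1, hp2, ← h2]; congr 1; omega
  obtain ⟨t, -, ht, h3, h4⟩ := exists_entry (g := fun t => X t p) (Nat.zero_le N)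
    (by simp only [i0]; omega) i1
  refine ⟨t, ht, ?_, h4⟩
  -- The diagonal entries of its row and column confine this cell to the values `k` and `k + 1`.
  have b1 := (h.vert t ht.le).le_diag_row p
  have b2 := (h.vert t ht.le).diag_col_le p
  rw [hp1, h2] at b1
  rw [hp2, h1] at b2
  have h3 : X t p ≠ k + 1 := h3
  omega

/-- If all moves between the consecutive levels `k` and `k + 1` occur at a single time, they go
upwards and include the cell next to the jump. -/
theorem IsTransit.exists_time {ℓ : ℕ → ℕ} {L N : ℕ} {X : ℕ → TriangleIndex n → ℕ}
    (hℓ : IsLevelSeq n L ℓ) (h : IsTransit n ℓ N X) (k : ℕ)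
    (huniq : ∀ t < N, ∀ t' < N, (HasMove X t k (k + 1) ∨ HasMove X t (k + 1) k) →
      (HasMove X t' k (k + 1) ∨ HasMove X t' (k + 1) k) → t = t') :
    ∃ τ, (∀ t < N, HasMove X t k (k + 1) → t = τ) ∧ (∀ t < N, ¬ HasMove X t (k + 1) k) ∧
      (k < L → τ < N ∧ HasMove X τ k (k + 1)) ∧
      ∀ s (hs : s + 1 < n), ℓ s = k → ℓ (s + 1) = k + 1 → ∀ t ≤ N,
        (t ≤ τ → X t (cell (s + 1) s hs (by omega)) = k) ∧
        (τ < t → X t (cell (s + 1) s hs (by omega)) = k + 1) := by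
  by_cases hk : k < L
  · obtain ⟨s₀, hs₀, e1, e2⟩ := hℓ.exists_jump hk
    obtain ⟨τ, hτ, m1, m2⟩ := h.exists_move hs₀ e1 e2
    have hup : HasMove X τ k (k + 1) := ⟨_, m1, m2⟩
    have hdown : ∀ t < N, ¬ HasMove X t (k + 1) k := fun t ht hm => by
      obtain rfl := huniq t ht τ hτ (.inr hm) (.inl hup)
      have := ((h.step t ht).hasMove_unique (by omega) (by omega) hup hm).1
      omega
    have hupτ : ∀ t < N, HasMove X t k (k + 1) → t = τ := fun t ht hm =>
      huniq t ht τ hτ (.inl hm) (.inl hup)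
    refine ⟨τ, hupτ, hdown, fun _ => ⟨hτ, hup⟩, fun s hs f1 f2 => ?_⟩
    obtain ⟨τ', hτ', m1', m2'⟩ := h.exists_move hs f1 f2
    obtain rfl := hupτ τ' hτ' ⟨_, m1', m2'⟩
    set p : TriangleIndex n := cell (s + 1) s hs (by omega)
    have range : ∀ t ≤ N, X t p = k ∨ X t p = k + 1 := fun t ht => by
      have b1 := (h.vert t ht).le_diag_row p
      have b2 := (h.vert t ht).diag_col_le p
      rw [show (p.1.1 : ℕ) = s + 1 from rfl, f2] at b1
      rw [show (p.1.2 : ℕ) = s from rfl, f1] at b2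
      omega
    refine fun t htN => ⟨fun ht => ?_, fun ht => ?_⟩
    · rcases range t htN with h0 | h0
      · exact h0
      · obtain ⟨t', h1, h2, h3, h4⟩ := exists_exit (g := fun t => X t p) ht h0
          (by simp only [m1']; omega)
        rcases range (t' + 1) (by omega) with h5 | h5
        · exact absurd ⟨p, h3, h5⟩ (hdown t' (by omega))
        · exact absurd h5 h4
    · rcases range t htN with h0 | h0
      · obtain ⟨t', h1, h2, h3, h4⟩ := exists_exit (g := fun t => X t p)
          (show τ' + 1 ≤ t from ht) m2' (by simp only [h0]; omega)
        rcases range (t' + 1) (by omega) with h5 | h5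
        · exact absurd ⟨p, h3, h5⟩ (hdown t' (by omega))
        · exact absurd h5 h4
      · exact h0
  · have hle : ∀ t ≤ N, ∀ p, X t p ≤ L := fun t ht p => by
      have b1 := (h.vert t ht).le_diag_row p
      have b2 := hℓ.mono (show (p.1.1 : ℕ) ≤ n - 1 by omega)
      rw [hℓ.last] at b2
      exact b1.trans b2
    refine ⟨N, fun t ht ⟨p, _, h2⟩ => ?_, fun t ht ⟨p, h2, _⟩ => ?_, fun h => absurd h hk,
      fun s hs _ f2 => ?_⟩
    · have := hle (t + 1) ht p
      omega
    · have := hle t ht.le p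
      omega
    · have b2 := hℓ.mono (show s + 1 ≤ n - 1 by omega)
      rw [hℓ.last] at b2
      omega

/-! ### The lower bound for the number of changes -/

theorem nbr_cell {i j : ℕ} {hi : i < n} {hj : j ≤ i} {z : TriangleIndex n}
    (h : Nbr (cell i j hi hj) z) :
    ((z.1.1 : ℕ) = i + 1 ∧ (z.1.2 : ℕ) = j) ∨ ((z.1.1 : ℕ) = i ∧ (z.1.2 : ℕ) = j + 1) ∨
      ((z.1.1 : ℕ) + 1 = i ∧ (z.1.2 : ℕ) = j) ∨ ((z.1.1 : ℕ) = i ∧ (z.1.2 : ℕ) + 1 = j) := by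
  simp only [Nbr, Covers, cell, Fin.ext_iff] at h
  omega

/-- If `d` consecutive levels account for `2 * d` moves, they may be merged. -/
theorem IsTransit.two_mul_le_of_merge {ℓ : ℕ → ℕ} {L N : ℕ} {X : ℕ → TriangleIndex n → ℕ}
    (h : IsTransit n ℓ N X) {k d : ℕ} (hkd : k + d ≤ L) (T : Finset ℕ) (hTd : 2 * d ≤ T.card)
    (hT : ∀ t ∈ T, t < N ∧ ∃ a b, a ≠ b ∧ k ≤ a ∧ a ≤ k + d ∧ k ≤ b ∧ b ≤ k + d ∧ HasMove X t a b)
    (ih : 2 * (L - d) ≤ changes (fun t => merge k d ∘ X t) N) : 2 * L ≤ changes X N := by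
  have := card_add_changes_comp_le h.step (merge k d) T fun t ht => by
    obtain ⟨h1, a, b, hab, h2, h3, h4, h5, h6⟩ := hT t ht
    refine ⟨h1, a, b, hab, ?_, h6⟩
    unfold merge
    omega
  omega

/-- Strong induction on `L` by merging levels. The end conditions on `ℓ` survive merging and
guarantee enough room around the jumps for the cells used below. -/
theorem IsTransit.two_mul_le_changes {L : ℕ} : ∀ {ℓ : ℕ → ℕ} {N : ℕ}
    {X : ℕ → TriangleIndex n → ℕ}, IsLevelSeq n L ℓ → ℓ 1 = 0 → ℓ (n - 2) = L → 2 ≤ n →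
    IsTransit n ℓ N X → 2 * L ≤ changes X N := by
  classical
  induction L using Nat.strong_induction_on with
  | _ L IH =>
  intro ℓ N X hℓ hfirst hlast hn h
  rcases Nat.eq_zero_or_pos L with rfl | hL
  · omega
  by_contra hcon
  -- In a minimal counterexample, `d` consecutive gaps never account for `2 * d` moves.
  have hmerge : ∀ k d, 0 < d → k + d ≤ L → ∀ T : Finset ℕ, 2 * d ≤ T.card →
      (∀ t ∈ T, t < N ∧ ∃ a b, a ≠ b ∧ k ≤ a ∧ a ≤ k + d ∧ k ≤ b ∧ b ≤ k + d ∧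
        HasMove X t a b) → False := by
    intro k d hd hkd T hTd hT
    refine hcon (h.two_mul_le_of_merge hkd T hTd hT ?_)
    refine IH (L - d) (by omega) (hℓ.merge hkd) ?_ ?_ hn (h.comp (merge_monotone k d))
    · simp [merge, hfirst]
    · simp only [merge, Function.comp_apply, hlast]
      omega
  have hle : ∀ t ≤ N, ∀ p, X t p ≤ L := fun t ht p => by
    have b1 := (h.vert t ht).le_diag_row p
    have b2 := hℓ.mono (show (p.1.1 : ℕ) ≤ n - 1 by omega)
    rw [hℓ.last] at b2
    exact b1.trans b2
  -- The case `d = 1`: consecutive levels exchange cells at no more than one time.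
  have htime := fun k => h.exists_time hℓ k fun t ht t' ht' hm hm' => by
    by_contra hne
    have hkL : k + 1 ≤ L := by
      rcases hm with ⟨p, h1, h2⟩ | ⟨p, h1, h2⟩
      · exact h2 ▸ hle _ ht p
      · exact h1 ▸ hle _ ht.le p
    refine hmerge k 1 one_pos hkL {t, t'} (by rw [Finset.card_pair hne]) fun u hu => ?_
    have hu' : u < N ∧ (HasMove X u k (k + 1) ∨ HasMove X u (k + 1) k) := by
      rcases Finset.mem_insert.1 hu with rfl | hu
      · exact ⟨ht, hm⟩
      · rw [Finset.mem_singleton.1 hu]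
        exact ⟨ht', hm'⟩
    refine ⟨hu'.1, ?_⟩
    rcases hu'.2 with h1 | h1
    · exact ⟨k, k + 1, by omega, by omega, by omega, by omega, by omega, h1⟩
    · exact ⟨k + 1, k, by omega, by omega, by omega, by omega, by omega, h1⟩
  obtain ⟨t₀, up0, dn0, mv0, loc0⟩ := htime 0
  obtain ⟨t₁, up1, dn1, mv1, loc1⟩ := htime 1
  obtain ⟨t₂, up2, dn2, mv2, -⟩ := htime 2
  obtain ⟨ht₀, mv0⟩ := mv0 hL
  -- the moves available to a single cell
  have tr : ∀ c, ∀ t < N, (X t c = 0 → X (t + 1) c = 1 → t = t₀) ∧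
      (X t c = 1 → X (t + 1) c ≠ 0) ∧ (X t c = 1 → X (t + 1) c = 2 → t = t₁) ∧
      (X t c = 2 → X (t + 1) c ≠ 1) ∧ (X t c = 3 → X (t + 1) c ≠ 2) := fun c t ht =>
    ⟨fun h1 h2 => up0 t ht ⟨c, h1, h2⟩, fun h1 h2 => dn0 t ht ⟨c, h1, h2⟩,
      fun h1 h2 => up1 t ht ⟨c, h1, h2⟩, fun h1 h2 => dn1 t ht ⟨c, h1, h2⟩,
      fun h1 h2 => dn2 t ht ⟨c, h1, h2⟩⟩
  have at_t₀ : ∀ c, X t₀ c ≠ X (t₀ + 1) c → X t₀ c = 0 ∧ X (t₀ + 1) c = 1 := fun c hc => by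
    have := (h.step t₀ ht₀).hasMove_unique (by omega) hc mv0 ⟨c, rfl, rfl⟩
    exact ⟨this.1.symm, this.2.symm⟩
  -- the cells near the first jump
  obtain ⟨s, hs, hs0, hs1⟩ := hℓ.exists_jump hL
  obtain ⟨u, rfl⟩ : ∃ u, s = u + 1 := by
    rcases s with _ | u
    · rw [zero_add, hfirst] at hs1
      omega
    · exact ⟨u, rfl⟩
  have hs0' : ℓ u = 0 := by
    have := hℓ.mono (Nat.le_succ u)
    simp only [Nat.succ_eq_add_one] at this
    omega
  have hs2 : ℓ (u + 3) ≤ 2 := by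
    have := hℓ.succ_le (u + 2)
    simp only [Nat.add_assoc] at this hs1
    norm_num at this hs1
    omega
  have hs1 : ℓ (u + 2) = 1 := hs1
  have hs : u + 2 < n := hs
  have hu4 : u + 3 < n := by
    by_contra hlt
    have := hℓ.mono (show n - 2 ≤ u + 1 by omega)
    omega
  -- In columns `u`, `u + 1`, `u + 2`, row `u + 2` contains `b`, `p₁` and a diagonal cell, and row
  -- `u + 3` contains `q₁`, `r` and later `p₂`. The later cells `o`, `q₂` lie in columns `u`, `u +
  -- 1` of row `u + 4`.
  obtain ⟨p₁, hp₁⟩ := exists_eq (a' := cell (n := n) (u + 2) (u + 1) hs (by omega))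
  obtain ⟨q₁, hq₁⟩ := exists_eq (a' := cell (n := n) (u + 3) u hu4 (by omega))
  obtain ⟨b, hb⟩ := exists_eq (a' := cell (n := n) (u + 2) u hs (by omega))
  obtain ⟨r, hr⟩ := exists_eq (a' := cell (n := n) (u + 3) (u + 1) hu4 (by omega))
  have cellval : ∀ i j (hi : i < n) (hj : j ≤ i), X 0 (cell i j hi hj) = ℓ ((i + j) / 2) ∧
      X N (cell i j hi hj) = ℓ ((i + j + 1) / 2) := fun i j hi hj => ⟨h.init _, h.final _⟩
  have cellle : ∀ i j (hi : i < n) (hj : j ≤ i), ∀ t ≤ N, X t (cell i j hi hj) ≤ ℓ i ∧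
      ℓ j ≤ X t (cell i j hi hj) :=
    fun i j hi hj t ht => ⟨(h.vert t ht).le_diag_row (cell i j hi hj), (h.vert t ht).diag_col_le (cell i j hi hj)⟩
  have p₁_loc : ∀ t ≤ N, (t ≤ t₀ → X t p₁ = 0) ∧ (t₀ < t → X t p₁ = 1) := by
    rw [hp₁]; exact loc0 (u + 1) hs hs0 hs1
  have q₁_init : X 0 q₁ = 0 ∧ X N q₁ = 1 := by
    have := cellval (u + 3) u hu4 (by omega)
    rw [show (u + 3 + u) / 2 = u + 1 by omega, show (u + 3 + u + 1) / 2 = u + 2 by omega] at this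
    rw [hq₁]; omega
  have q₁_le : ∀ t ≤ N, X t q₁ ≤ 2 := fun t ht => by
    have := cellle (u + 3) u hu4 (by omega) t ht
    rw [hq₁]; omega
  have b_init : X 0 b = 0 ∧ X N b = 0 := by
    have := cellval (u + 2) u hs (by omega)
    rw [show (u + 2 + u) / 2 = u + 1 by omega, show (u + 2 + u + 1) / 2 = u + 1 by omega] at this
    rw [hb]; omega
  have b_le : ∀ t ≤ N, X t b ≤ 1 := fun t ht => by
    have := cellle (u + 2) u hs (by omega) t ht
    rw [hb]; omega
  have r_init : X 0 r = 1 ∧ X N r = 1 := by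
    have := cellval (u + 3) (u + 1) hu4 (by omega)
    rw [show (u + 3 + (u + 1)) / 2 = u + 2 by omega,
      show (u + 3 + (u + 1) + 1) / 2 = u + 2 by omega] at this
    rw [hr]; omega
  have r_le : ∀ t ≤ N, X t r ≤ ℓ (u + 3) := fun t ht => by
    rw [hr]; exact (cellle (u + 3) (u + 1) hu4 (by omega) t ht).1
  -- `q₁` and hence `r` move together with `p₁`
  have q₁_move : X t₀ q₁ = 0 ∧ X (t₀ + 1) q₁ = 1 := by
    obtain ⟨t, -, ht, e1, e2⟩ := exists_entry (g := fun t => X t q₁) (Nat.zero_le N)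
      (by simp only [q₁_init.1]; omega) q₁_init.2
    have e3 := tr q₁ t ht
    have e4 := q₁_le t ht.le
    have e1 : X t q₁ ≠ 1 := e1
    have e2 : X (t + 1) q₁ = 1 := e2
    obtain rfl : t = t₀ := e3.1 (by omega) e2
    exact ⟨by omega, e2⟩
  have r_move : X t₀ r = 0 ∧ X (t₀ + 1) r = 1 := by
    have hpq : p₁ ≠ q₁ := fun e => by
      have := congrArg (fun p : TriangleIndex n => (p.1.1 : ℕ)) e
      simp [hp₁, hq₁, cell] at this
    have e1 := (p₁_loc t₀ ht₀.le).1 le_rfl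
    have e2 := (p₁_loc (t₀ + 1) ht₀).2 (by omega)
    -- As `p₁` and `q₁` change together, so does a neighbour of `p₁`. Diagonal cells are fixed, and
    -- `b` could not return from 1 to its final value 0; this leaves `r`.
    obtain ⟨z, hz, hzne⟩ := (h.step t₀ ht₀).exists_nbr hpq (by omega) (by omega)
    have hdiag : (z.1.1 : ℕ) ≠ z.1.2 := fun e => by
      have : z = diagCell z.1.1 := TriangleIndex.ext_val rfl e.symm
      rw [this, (h.vert _ ht₀.le).diag, (h.vert (t₀ + 1) ht₀).diag] at hzne
      exact hzne rfl
    rw [hp₁] at hz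
    rcases nbr_cell hz with hz | hz | hz | hz
    · obtain rfl : z = r := TriangleIndex.ext_val (by rw [hr]; exact hz.1) (by rw [hr]; exact hz.2)
      exact at_t₀ _ hzne
    · omega
    · omega
    · obtain rfl : z = b := TriangleIndex.ext_val (by rw [hb]; exact hz.1)
        (by rw [hb]; exact Nat.succ_injective hz.2)
      have e3 := at_t₀ _ hzne
      obtain ⟨t, h1, h2, h3, h4⟩ := exists_exit (g := fun t => X t z)
        (show t₀ + 1 ≤ N from ht₀) e3.2 (by simp only [b_init.2]; omega)
      have e4 := tr z t h2
      have e5 := b_le (t + 1) h2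
      have h3 : X t z = 1 := h3
      have h4 : X (t + 1) z ≠ 1 := h4
      omega
  -- `r` starts at 1, is 0 at `t₀`, and cannot move from 1 to 0, so it must drop from 2.
  obtain ⟨tJ, htJ, rJ2, rJ0⟩ : ∃ t < t₀, X t r = 2 ∧ X (t + 1) r = 0 := by
    obtain ⟨t, -, ht, e1, e2⟩ := exists_entry (g := fun t => X t r) (Nat.zero_le t₀)
      (by simp only [r_init.1]; omega) r_move.1
    have e3 := tr r t (by omega)
    have e4 := r_le t (by omega)
    have e1 : X t r ≠ 0 := e1
    have e2 : X (t + 1) r = 0 := e2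
    exact ⟨t, ht, by omega, e2⟩
  have hs2 : ℓ (u + 3) = 2 := by
    have := r_le tJ (by omega)
    omega
  have hL2 : 2 ≤ L := by
    have := hle tJ (by omega) r
    omega
  obtain ⟨ht₁, mv1⟩ := mv1 (by omega)
  have hu5 : u + 4 < n := by
    by_contra hlt
    have := hℓ.mono (show n - 2 ≤ u + 2 by omega)
    omega
  have hs3 : ℓ (u + 4) ≤ 3 := by
    have := hℓ.succ_le (u + 3)
    rw [hs2] at this
    exact this
  obtain ⟨p₂, hp₂⟩ := exists_eq (a' := cell (n := n) (u + 3) (u + 2) hu4 (by omega))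
  obtain ⟨q₂, hq₂⟩ := exists_eq (a' := cell (n := n) (u + 4) (u + 1) hu5 (by omega))
  obtain ⟨o, ho⟩ := exists_eq (a' := cell (n := n) (u + 4) u hu5 (by omega))
  have p₂_loc : ∀ t ≤ N, (t ≤ t₁ → X t p₂ = 1) ∧ (t₁ < t → X t p₂ = 2) := by
    rw [hp₂]; exact loc1 (u + 2) hu4 hs1 hs2
  have q₂_init : X 0 q₂ = 1 ∧ X N q₂ = 2 := by
    have := cellval (u + 4) (u + 1) hu5 (by omega)
    rw [show (u + 4 + (u + 1)) / 2 = u + 2 by omega,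
      show (u + 4 + (u + 1) + 1) / 2 = u + 3 by omega] at this
    rw [hq₂]; omega
  have o_init : X 0 o = 1 ∧ X N o = 1 := by
    have := cellval (u + 4) u hu5 (by omega)
    rw [show (u + 4 + u) / 2 = u + 2 by omega, show (u + 4 + u + 1) / 2 = u + 2 by omega] at this
    rw [ho]; omega
  have q₂_le : ∀ t ≤ N, X t q₂ ≤ 3 := fun t ht => by
    have := cellle (u + 4) (u + 1) hu5 (by omega) t ht
    rw [hq₂]; omega
  have r_le_p₂ : ∀ t ≤ N, X t r ≤ X t p₂ := fun t ht => by
    rw [hr, hp₂]; exact (h.vert t ht).le_of_le le_rfl (by simp [cell])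
  have r_le_q₂ : ∀ t ≤ N, X t r ≤ X t q₂ := fun t ht => by
    rw [hr, hq₂]; exact (h.vert t ht).le_of_le (by simp [cell]) le_rfl
  have q₁_le_o : ∀ t ≤ N, X t q₁ ≤ X t o := fun t ht => by
    rw [hq₁, ho]; exact (h.vert t ht).le_of_le (by simp [cell]) le_rfl
  have o_le_q₂ : ∀ t ≤ N, X t o ≤ X t q₂ := fun t ht => by
    rw [ho, hq₂]; exact (h.vert t ht).le_of_le le_rfl (by simp [cell])
  have q₁_le_q₂ : ∀ t ≤ N, X t q₁ ≤ X t q₂ := fun t ht => (q₁_le_o t ht).trans (o_le_q₂ t ht)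
  have ht₁J : t₁ < tJ := by
    by_contra hlt
    have e1 := (p₂_loc tJ (by omega)).1 (by omega)
    have e2 := r_le_p₂ tJ (by omega)
    omega
  have mvJ : HasMove X tJ 2 0 := ⟨r, rJ2, rJ0⟩
  have ne_of_moves : ∀ {t t' a b a' b' : ℕ}, t < N → HasMove X t a b → HasMove X t' a' b' →
      a ≠ b → a' ≠ b' → (a ≠ a' ∨ b ≠ b') → t ≠ t' := by
    rintro t t' a b a' b' ht h1 h2 hab hab' hne rfl
    have := (h.step t ht).hasMove_unique hab hab' h1 h2
    omega
  -- only one move between the levels `0` and `2`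
  have onlyJ : ∀ t < N, (HasMove X t 0 2 ∨ HasMove X t 2 0) → t = tJ := by
    intro t ht hm
    by_contra hne
    have hm' : ∃ a b, a ≠ b ∧ 0 ≤ a ∧ a ≤ 0 + 2 ∧ 0 ≤ b ∧ b ≤ 0 + 2 ∧ (a + b = 2) ∧ a ≠ 1 ∧
        HasMove X t a b := by
      rcases hm with hm | hm
      · exact ⟨0, 2, by omega, by omega, by omega, by omega, by omega, by omega, by omega, hm⟩
      · exact ⟨2, 0, by omega, by omega, by omega, by omega, by omega, by omega, by omega, hm⟩
    obtain ⟨a, c, hac, k1, k2, k3, k4, k5, k6, hm'⟩ := hm'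
    have n1 : t ≠ t₀ := ne_of_moves ht hm' mv0 hac (by omega) (by omega)
    have n2 : t ≠ t₁ := ne_of_moves ht hm' mv1 hac (by omega) (by omega)
    -- The times `tJ`, `t₀`, `t₁` already give three moves among the levels 0, 1, 2; a fourth is the
    -- excluded case `d = 2`.
    refine hmerge 0 2 (by omega) (by omega) {t, tJ, t₀, t₁} ?_ ?_
    · rw [Finset.card_insert_of_notMem (by simp; omega),
        Finset.card_insert_of_notMem (by simp; omega), Finset.card_pair (by omega)]
    · intro w hw
      simp only [Finset.mem_insert, Finset.mem_singleton] at hw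
      rcases hw with rfl | rfl | rfl | rfl
      · exact ⟨ht, a, c, hac, k1, k2, k3, k4, hm'⟩
      · exact ⟨by omega, 2, 0, by omega, by omega, by omega, by omega, by omega, mvJ⟩
      · exact ⟨by omega, 0, 1, by omega, by omega, by omega, by omega, by omega, mv0⟩
      · exact ⟨by omega, 1, 2, by omega, by omega, by omega, by omega, by omega, mv1⟩
  have no02 : ∀ c, ∀ t < N, X t c = 0 → X (t + 1) c ≠ 2 := fun c t ht h1 h2 => by
    have hm : HasMove X t 0 2 := ⟨c, h1, h2⟩
    obtain rfl := onlyJ t ht (.inl hm)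
    exact ne_of_moves ht hm mvJ (by omega) (by omega) (by omega) rfl
  have q₁_before : ∀ t ≤ t₀, X t q₁ = 0 := by
    intro t ht
    by_contra hne
    obtain ⟨t', h1, h2, h3, h4⟩ := exists_exit (g := fun t => X t q₁) (Nat.zero_le t) q₁_init.1 hne
    have h3 : X t' q₁ = 0 := h3
    have h4 : X (t' + 1) q₁ ≠ 0 := h4
    have e1 := tr q₁ t' (by omega)
    have e2 := no02 q₁ t' (by omega) h3
    have e3 := q₁_le (t' + 1) (by omega)
    omega
  have q₁_after : ∀ t ≤ N, t₀ < t → X t q₁ = 1 := by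
    intro t htN ht
    by_contra hne
    obtain ⟨t', h1, h2, h3, h4⟩ := exists_exit (g := fun t => X t q₁)
      (show t₀ + 1 ≤ t from ht) q₁_move.2 hne
    have h3 : X t' q₁ = 1 := h3
    have h4 : X (t' + 1) q₁ ≠ 1 := h4
    have e1 := tr q₁ t' (by omega)
    have e3 := q₁_le (t' + 1) (by omega)
    omega
  have q₂_after : ∀ t ≤ N, t₁ < t → X t q₂ = 2 := by
    intro t htN ht
    by_contra hne
    obtain ⟨t', h1, h2, h3, h4⟩ := exists_entry (g := fun t => X t q₂) htN hne q₂_init.2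
    have h3 : X t' q₂ ≠ 2 := h3
    have h4 : X (t' + 1) q₂ = 2 := h4
    have e1 := tr q₂ t' (by omega)
    have e2 := no02 q₂ t' (by omega)
    have e3 := q₂_le t' (by omega)
    omega
  -- After `t₀`, `q₁ = 1` and `q₂ = 2` enclose `o`, so it could enter level 1 only from 2, which is
  -- excluded.
  have o_after : X (t₀ + 1) o = 1 := by
    by_contra hne
    obtain ⟨t', h1, h2, h3, h4⟩ := exists_entry (g := fun t => X t o) (show t₀ + 1 ≤ N from ht₀)
      hne o_init.2
    have h3 : X t' o ≠ 1 := h3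
    have h4 : X (t' + 1) o = 1 := h4
    have e1 := tr o t' (by omega)
    have e2 := q₁_after t' (by omega) (by omega)
    have e3 := q₂_after t' (by omega) (by omega)
    have e4 := q₁_le_o t' (by omega)
    have e5 := o_le_q₂ t' (by omega)
    omega
  -- between `t₁` and `t₀` the level set of `1` is a single diagonal cell
  have o_ne : ∀ t, t₁ < t → t ≤ t₀ → X t o ≠ 1 := by
    intro t h1 h2 h3
    obtain ⟨i, hi⟩ := (h.vert t (by omega)).joined o
    have hdi : X t (diagCell i) = 1 := (hi.mem rfl).trans h3
    rw [(h.vert t (by omega)).diag] at hdi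
    have hiu : (i : ℕ) = u + 2 := by
      have c1 : ¬ (i : ℕ) ≤ u + 1 := fun hc => by have := hℓ.mono hc; omega
      have c2 : ¬ u + 3 ≤ (i : ℕ) := fun hc => by have := hℓ.mono hc; omega
      omega
    have hcell : diagCell i = cell (u + 2) (u + 2) hs le_rfl := TriangleIndex.ext_val hiu hiu
    rcases ReflTransGen.cases_head hi.symm with e | ⟨z, hz, -⟩
    · rw [hcell, ho] at e
      have := congrArg (fun p : TriangleIndex n => (p.1.1 : ℕ)) e
      simp [cell] at this
    · have hz1 : X t z = 1 := Eq.trans hz.2.2 h3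
      have hzn := hz.1
      rw [hcell] at hzn
      have hz2 : (z.1.2 : ℕ) ≤ z.1.1 := z.2
      rcases nbr_cell hzn with hz | hz | hz | hz
      · obtain rfl : z = p₂ := TriangleIndex.ext_val (by rw [hp₂]; exact hz.1)
          (by rw [hp₂]; exact hz.2)
        have := (p₂_loc t (by omega)).2 h1
        omega
      · omega
      · omega
      · obtain rfl : z = p₁ := TriangleIndex.ext_val (by rw [hp₁]; exact hz.1)
          (by rw [hp₁]; exact Nat.succ_injective hz.2)
        have := (p₁_loc t (by omega)).1 h2
        omega
  have o_t₀ : X t₀ o = 0 := by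
    have e1 := o_ne t₀ (by omega) le_rfl
    exact (at_t₀ o (by omega)).1
  -- No neighbour of `r` drops from 2 to 0 at `tJ`, so by connectedness `r` changes alone.
  have o_notJ : ¬ (X tJ o = 2 ∧ X (tJ + 1) o = 0) := by
    rintro ⟨h1, h2⟩
    have hro : r ≠ o := fun e => by
      have := congrArg (fun p : TriangleIndex n => (p.1.1 : ℕ)) e
      simp [hr, ho, cell] at this
    obtain ⟨z, hz, hzne⟩ := (h.step tJ (by omega)).exists_nbr hro (by omega) (by omega)
    have e := (h.step tJ (by omega)).hasMove_unique (by omega) hzne mvJ ⟨z, rfl, rfl⟩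
    rw [hr] at hz
    rcases nbr_cell hz with hz | hz | hz | hz
    · obtain rfl : z = q₂ := TriangleIndex.ext_val (by rw [hq₂]; exact hz.1)
        (by rw [hq₂]; exact hz.2)
      have := q₂_after (tJ + 1) (by omega) (by omega)
      omega
    · obtain rfl : z = p₂ := TriangleIndex.ext_val (by rw [hp₂]; exact hz.1)
        (by rw [hp₂]; exact hz.2)
      have := (p₂_loc (tJ + 1) (by omega)).2 (by omega)
      omega
    · obtain rfl : z = p₁ := TriangleIndex.ext_val
        (by rw [hp₁]; exact Nat.succ_injective hz.1) (by rw [hp₁]; exact hz.2)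
      have := (p₁_loc tJ (by omega)).1 (by omega)
      omega
    · obtain rfl : z = q₁ := TriangleIndex.ext_val (by rw [hq₁]; exact hz.1)
        (by rw [hq₁]; exact Nat.succ_injective hz.2)
      have := q₁_before tJ (by omega)
      omega
  -- hence `o` reached level `0` from level `3` before `t₁`
  obtain ⟨t₃, ht₃, o₃⟩ : ∃ t < t₁, X t o = 3 := by
    obtain ⟨t, -, ht, e1, e2⟩ := exists_entry (g := fun t => X t o) (Nat.zero_le t₀)
      (by simp only [o_init.1]; omega) o_t₀
    have e1 : X t o ≠ 0 := e1
    have e2 : X (t + 1) o = 0 := e2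
    have f1 := tr o t (by omega)
    have f2 := o_le_q₂ t (by omega)
    have f3 := q₂_le t (by omega)
    have f4 : X t o = 2 → t = tJ := fun h2 => onlyJ t (by omega) (.inr ⟨o, h2, e2⟩)
    have f5 : X t o ≠ 2 := fun h2 => by
      obtain rfl := f4 h2
      exact o_notJ ⟨h2, e2⟩
    have f6 : ¬ t₁ < t := fun hlt => by
      have := q₂_after t (by omega) hlt
      omega
    have f7 : t ≠ t₁ := by
      rintro rfl
      exact ne_of_moves ht₁ mv1 ⟨o, rfl, rfl⟩ (by omega) (by omega) (by omega) rfl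
    exact ⟨t, by omega, by omega⟩
  have q₂₃ : X t₃ q₂ = 3 := by
    have e1 := o_le_q₂ t₃ (by omega)
    have e2 := q₂_le t₃ (by omega)
    omega
  have r_before : ∀ t ≤ t₁, X t r = 1 := by
    intro t ht
    by_contra hne
    obtain ⟨t', h1, h2, h3, h4⟩ := exists_exit (g := fun t => X t r) (Nat.zero_le t) r_init.1 hne
    have h3 : X t' r = 1 := h3
    have h4 : X (t' + 1) r ≠ 1 := h4
    have e1 := tr r t' (by omega)
    have e2 := r_le (t' + 1) (by omega)
    omega
  -- `q₂` can enter level 2 only from 1, and that only in the step starting at `t₁`.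
  have q₂_ne : ∀ t ≤ t₁, X t q₂ ≠ 2 := by
    intro t ht h2
    obtain ⟨t', h1, h2, h3, h4⟩ := exists_entry (g := fun t => X t q₂) (Nat.zero_le t)
      (by simp only [q₂_init.1]; omega) h2
    have h3 : X t' q₂ ≠ 2 := h3
    have h4 : X (t' + 1) q₂ = 2 := h4
    have e1 := tr q₂ t' (by omega)
    have e2 := no02 q₂ t' (by omega)
    have e3 := q₂_le t' (by omega)
    omega
  have q₂_before : ∀ t ≤ t₁, X t q₂ = 1 ∨ X t q₂ = 3 := by
    intro t ht
    have e1 := q₂_ne t ht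
    have e2 := r_before t ht
    have e3 := r_le_q₂ t (by omega)
    have e4 := q₂_le t (by omega)
    omega
  have q₂_t₁ : X t₁ q₂ = 1 := by
    have e1 := q₂_after (t₁ + 1) (by omega) (by omega)
    have e2 := tr q₂ t₁ ht₁
    have e3 := q₂_before t₁ le_rfl
    omega
  obtain ⟨tA, -, hA, A1, A2⟩ := exists_entry (g := fun t => X t q₂) (Nat.zero_le t₃)
    (by simp only [q₂_init.1]; omega) q₂₃
  obtain ⟨tB, -, hB, B1, B2⟩ := exists_exit (g := fun t => X t q₂) ht₃.le q₂₃
    (by simp only [q₂_t₁]; omega)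
  have mvA : HasMove X tA 1 3 := ⟨q₂, (q₂_before tA (by omega)).resolve_right A1, A2⟩
  have mvB : HasMove X tB 3 1 := ⟨q₂, B1, (q₂_before (tB + 1) (by omega)).resolve_right B2⟩
  have hL3 : 3 ≤ L := by
    have := hle t₃ (by omega) o
    omega
  obtain ⟨ht₂, mv2⟩ := mv2 (by omega)
  have n1 : tA ≠ tB := ne_of_moves (by omega) mvA mvB (by omega) (by omega) (by omega)
  have n2 : tA ≠ t₂ := ne_of_moves (by omega) mvA mv2 (by omega) (by omega) (by omega)
  have n3 : tB ≠ t₂ := ne_of_moves (by omega) mvB mv2 (by omega) (by omega) (by omega)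
  have n4 : t₁ ≠ t₂ := ne_of_moves (by omega) mv1 mv2 (by omega) (by omega) (by omega)
  -- The moves 1 → 3, 3 → 1, 1 → 2 and 2 → 3 occur at distinct times: the excluded case `d = 2`.
  refine hmerge 1 2 (by omega) (by omega) {tA, tB, t₁, t₂} ?_ ?_
  · rw [Finset.card_insert_of_notMem (by simp; omega),
      Finset.card_insert_of_notMem (by simp; omega), Finset.card_pair (by omega)]
  · intro w hw
    simp only [Finset.mem_insert, Finset.mem_singleton] at hw
    rcases hw with rfl | rfl | rfl | rfl
    · exact ⟨by omega, 1, 3, by omega, by omega, by omega, by omega, by omega, mvA⟩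
    · exact ⟨by omega, 3, 1, by omega, by omega, by omega, by omega, by omega, mvB⟩
    · exact ⟨by omega, 1, 2, by omega, by omega, by omega, by omega, by omega, mv1⟩
    · exact ⟨by omega, 2, 3, by omega, by omega, by omega, by omega, by omega, mv2⟩

/-! ### Steps that lower part of a level set -/

theorem joinedIn_column {S : Set (TriangleIndex n)} {p q : TriangleIndex n}
    (hcol : (p.1.2 : ℕ) = q.1.2) (hrow : (p.1.1 : ℕ) ≤ q.1.1)
    (hS : ∀ r : TriangleIndex n, (r.1.2 : ℕ) = p.1.2 → (p.1.1 : ℕ) ≤ r.1.1 →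
      (r.1.1 : ℕ) ≤ q.1.1 → r ∈ S) : JoinedIn S p q := by
  have hp : (p.1.2 : ℕ) ≤ p.1.1 := p.2
  have hqn := q.1.1.2
  have key : ∀ d (hd : (p.1.1 : ℕ) + d ≤ q.1.1),
      JoinedIn S p (cell (p.1.1 + d) p.1.2 (by omega) (by omega)) := by
    intro d
    induction d with
    | zero => exact fun _ => .refl
    | succ d ih =>
      exact fun hd => .tail (ih (by omega)) ⟨.inl (.inl ⟨rfl, rfl⟩),
        hS _ rfl (by simp [cell]) (by simp [cell]; omega),
        hS _ rfl (by simp [cell]) (by simpa [cell] using hd)⟩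
  have := key (q.1.1 - p.1.1) (by omega)
  rwa [show cell (p.1.1 + (q.1.1 - p.1.1)) p.1.2 (by omega) (by omega) = q from
    TriangleIndex.ext_val (by simp [cell]; omega) (by simpa [cell] using hcol)] at this

theorem joinedIn_row {S : Set (TriangleIndex n)} {p q : TriangleIndex n}
    (hrow : (p.1.1 : ℕ) = q.1.1) (hcol : (p.1.2 : ℕ) ≤ q.1.2)
    (hS : ∀ r : TriangleIndex n, (r.1.1 : ℕ) = p.1.1 → (p.1.2 : ℕ) ≤ r.1.2 →
      (r.1.2 : ℕ) ≤ q.1.2 → r ∈ S) : JoinedIn S p q := by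
  have hq : (q.1.2 : ℕ) ≤ q.1.1 := q.2
  have hpn := p.1.1.2
  have key : ∀ d (hd : (p.1.2 : ℕ) + d ≤ q.1.2),
      JoinedIn S p (cell p.1.1 (p.1.2 + d) hpn (by omega)) := by
    intro d
    induction d with
    | zero => exact fun _ => .refl
    | succ d ih =>
      exact fun hd => .tail (ih (by omega)) ⟨.inl (.inr ⟨rfl, rfl⟩),
        hS _ rfl (by simp [cell]) (by simp [cell]; omega),
        hS _ rfl (by simp [cell]) (by simpa [cell] using hd)⟩
  have := key (q.1.2 - p.1.2) (by omega)
  rwa [show cell p.1.1 (p.1.2 + (q.1.2 - p.1.2)) hpn (by omega) = q from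
    TriangleIndex.ext_val (by simpa [cell] using hrow) (by simp [cell]; omega)] at this

/-- Lowering a connected part `C` of a level set to the largest value adjacent from below. -/
theorem IsVertexArray.exists_pushdown {α : Type*} [LinearOrder α] {ℓ : Fin n → α}
    {x : TriangleIndex n → α} (hx : IsVertexArray ℓ x) {C : Set (TriangleIndex n)} {θ : α}
    (hθ : ∀ p ∈ C, x p = θ) (hconn : ∀ p ∈ C, ∀ q ∈ C, JoinedIn C p q)
    (hdiag : ∀ i, diagCell i ∉ C) (hlow : ∀ p q, Covers p q → p ∉ C → q ∈ C → x p < θ)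
    (hrest : ∀ p ∉ C, x p = θ → ∃ i, JoinedIn {q | x q = θ ∧ q ∉ C} p (diagCell i)) :
    ∃ y, IsVertexArray ℓ y ∧ IsStep x y ∧ (∀ p ∈ C, y p < θ) ∧ ∀ p ∉ C, y p = x p := by
  classical
  rcases C.eq_empty_or_nonempty with rfl | hne
  · refine ⟨x, hx, ?_, fun p hp => absurd hp (Set.notMem_empty p), fun _ _ => rfl⟩
    exact ⟨⟨θ, θ, fun _ h => absurd rfl h⟩, fun _ _ h => absurd rfl h⟩
  obtain ⟨q₀, hq₀, hmin⟩ := Set.exists_min_image C (fun p => (p.1.1 : ℕ)) (Set.toFinite C) hne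
  have hq₀' : (q₀.1.2 : ℕ) < q₀.1.1 := by
    refine lt_of_le_of_ne q₀.2 fun h => hdiag q₀.1.1 ?_
    have : q₀ = diagCell q₀.1.1 := TriangleIndex.ext_val rfl h
    exact this ▸ hq₀
  have hq₀n := q₀.1.1.2
  -- The cell above a topmost cell `q₀` of `C` is outside `C`; it exists because `q₀` is off the
  -- diagonal.
  have hSne : {p | p ∉ C ∧ ∃ q ∈ C, Covers p q}.Nonempty := by
    refine ⟨cell (q₀.1.1 - 1) q₀.1.2 (by omega) (by omega), fun hmem => ?_, q₀, hq₀,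
      .inl ⟨by simp [cell]; omega, rfl⟩⟩
    have := hmin _ hmem
    simp only [cell] at this
    omega
  -- Choosing the maximum keeps the array monotone, and `p₀` links `C` to a level set that reaches
  -- the diagonal.
  obtain ⟨p₀, ⟨hp₀, q₁, hq₁, hcov⟩, hmax⟩ :=
    Set.exists_max_image _ x (Set.toFinite _) hSne
  have hβ := hlow p₀ q₁ hcov hp₀ hq₁
  let y : TriangleIndex n → α := fun p => if p ∈ C then x p₀ else x p
  have hyC : ∀ p ∈ C, y p = x p₀ := fun p hp => if_pos hp
  have hyC' : ∀ p ∉ C, y p = x p := fun p hp => if_neg hp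
  have hne' : ∀ p, x p ≠ y p ↔ p ∈ C := fun p => by
    by_cases hp : p ∈ C
    · simp only [hyC p hp, hθ p hp, hp, iff_true]
      exact hβ.ne'
    · simp [hyC' p hp, hp]
  refine ⟨y, ⟨⟨fun i => ?_, fun p q hpq => ?_⟩, fun p => ?_⟩, ⟨⟨θ, x p₀, fun p hp => ?_⟩,
    fun p q hp hq => ?_⟩, fun p hp => (hyC p hp).trans_lt hβ, hyC'⟩
  · rw [hyC' _ (hdiag i), hx.diag]
  · by_cases hp : p ∈ C <;> by_cases hq : q ∈ C
    · rw [hyC p hp, hyC q hq]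
    · rw [hyC p hp, hyC' q hq]
      exact hβ.le.trans ((hθ p hp).symm.le.trans (hx.mono p q hpq))
    · rw [hyC' p hp, hyC q hq]
      exact hmax p ⟨hp, q, hq, hpq⟩
    · rw [hyC' p hp, hyC' q hq]
      exact hx.mono p q hpq
  · have hlevel : ∀ p, x p ≠ θ → ∃ i, JoinedIn {q | y q = x p} p (diagCell i) := fun p hp =>
      (hx.joined p).imp fun i hi => hi.mono fun q (hq : x q = x p) => by
        have : q ∉ C := fun h => hp (hq.symm.trans (hθ q h))
        exact (hyC' q this).trans hq
    by_cases hp : p ∈ C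
    · obtain ⟨i, hi⟩ := hlevel p₀ hβ.ne
      refine ⟨i, ?_⟩
      rw [hyC p hp]
      refine JoinedIn.trans ((hconn p hp q₁ hq₁).mono fun q hq => hyC q hq) (.head ?_ hi)
      exact ⟨.inr hcov, hyC q₁ hq₁, hyC' p₀ hp₀⟩
    · rw [hyC' p hp]
      by_cases hpθ : x p = θ
      · obtain ⟨i, hi⟩ := hrest p hp hpθ
        refine ⟨i, hi.mono fun q hq => ?_⟩
        exact (hyC' q hq.2).trans (hq.1.trans hpθ.symm)
      · exact hlevel p hpθ
  · have hp' := (hne' p).1 hp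
    exact ⟨hθ p hp', hyC p hp'⟩
  · refine (hconn p ((hne' p).1 hp) q ((hne' q).1 hq)).mono fun r hr => (hne' r).2 hr

/-- All cells of level `θ` outside the columns with diagonal entry `θ` can be lowered in one
step. -/
theorem IsVertexArray.exists_settle {α : Type*} [LinearOrder α] {ℓ : Fin n → α} (hℓ : Monotone ℓ)
    {x : TriangleIndex n → α} (hx : IsVertexArray ℓ x) (θ : α) :
    ∃ y, IsVertexArray ℓ y ∧ IsStep x y ∧ (∀ p, y p = θ → ℓ p.1.2 = θ) ∧
      (∀ p, x p ≠ θ → y p = x p) ∧ ∀ p, y p ≤ x p := by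
  let C : Set (TriangleIndex n) := {p | x p = θ ∧ ℓ p.1.2 < θ}
  -- A path from `C` to the diagonal has to leave `C`, which is possible only from the last column
  -- with diagonal entry below `θ`.
  have hexit : ∀ p ∈ C, ∃ q ∈ C, JoinedIn C p q ∧
      ∃ j : Fin n, (j : ℕ) = q.1.2 + 1 ∧ θ ≤ ℓ j := by
    intro p hp
    obtain ⟨i, hi⟩ := hx.joined p
    have hθi : θ ≤ ℓ i := by
      have : x (diagCell i) = x p := hi.mem rfl
      rw [← hx.diag, this, hp.1]
    have aux : ∀ b, JoinedIn {q | x q = x p} p b → (b ∈ C ∧ JoinedIn C p b) ∨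
        ∃ q ∈ C, JoinedIn C p q ∧ ∃ j : Fin n, (j : ℕ) = q.1.2 + 1 ∧ θ ≤ ℓ j := by
      intro b hb
      induction hb with
      | refl => exact .inl ⟨hp, .refl⟩
      | @tail b c _ hbc ih =>
        rcases ih with ⟨hbC, hpb⟩ | h
        · have hcθ : x c = θ := Eq.trans hbc.2.2 hp.1
          by_cases hc : c ∈ C
          · exact .inl ⟨hc, .tail hpb ⟨hbc.1, hbC, hc⟩⟩
          · have hcge : θ ≤ ℓ c.1.2 := not_lt.1 fun h => hc ⟨hcθ, h⟩
            have hlt : b.1.2 < c.1.2 := by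
              by_contra hle
              exact absurd (hbC.2.trans_le hcge) (not_lt.2 (hℓ (not_lt.1 hle)))
            have hlt' : (b.1.2 : ℕ) < c.1.2 := hlt
            refine .inr ⟨b, hbC, hpb, c.1.2, ?_, hcge⟩
            rcases hbc.1 with (⟨_, h⟩ | ⟨_, h⟩) | (⟨_, h⟩ | ⟨_, h⟩)
            · rw [h] at hlt'; omega
            · exact h
            · rw [h] at hlt'; omega
            · omega
        · exact .inr h
    rcases aux _ hi with ⟨hiC, -⟩ | h
    · exact absurd hiC.2 (not_lt.2 hθi)
    · exact h
  have hcolumn : ∀ p ∈ C, ∀ q ∈ C, (p.1.2 : ℕ) = q.1.2 → (p.1.1 : ℕ) ≤ q.1.1 → JoinedIn C p q := by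
    intro p hp q hq hpq hle
    refine joinedIn_column hpq hle fun r hr1 hr2 hr3 => ⟨le_antisymm ?_ ?_, ?_⟩
    · exact hq.1 ▸ hx.le_of_le hr3 (by omega)
    · exact hp.1 ▸ hx.le_of_le hr2 (by omega)
    · rw [show r.1.2 = p.1.2 from Fin.ext hr1]
      exact hp.2
  have hconn : ∀ p ∈ C, ∀ q ∈ C, JoinedIn C p q := by
    intro p hp q hq
    obtain ⟨p', hp', hpp', j, hj, hjθ⟩ := hexit p hp
    obtain ⟨q', hq', hqq', k, hk, hkθ⟩ := hexit q hq
    have hcol : (p'.1.2 : ℕ) = q'.1.2 := by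
      have h1 : ¬ j ≤ q'.1.2 := fun h => absurd (hjθ.trans (hℓ h)) (not_le.2 hq'.2)
      have h2 : ¬ k ≤ p'.1.2 := fun h => absurd (hkθ.trans (hℓ h)) (not_le.2 hp'.2)
      rw [Fin.le_def] at h1 h2
      omega
    refine hpp'.trans (JoinedIn.trans ?_ hqq'.symm)
    rcases le_total (p'.1.1 : ℕ) q'.1.1 with h | h
    · exact hcolumn p' hp' q' hq' hcol h
    · exact (hcolumn q' hq' p' hp' hcol.symm h).symm
  have hdiag : ∀ i, diagCell i ∉ C := by
    intro i hi
    have h1 : x (diagCell i) = θ := hi.1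
    rw [hx.diag] at h1
    exact hi.2.ne h1
  have hlow : ∀ p q, Covers p q → p ∉ C → q ∈ C → x p < θ := by
    intro p q hpq hp hq
    refine lt_of_le_of_ne (hq.1 ▸ hx.mono p q hpq) fun h => hp ⟨h, lt_of_le_of_lt (hℓ ?_) hq.2⟩
    rcases hpq with ⟨_, h⟩ | ⟨_, h⟩
    · exact h.ge
    · exact Fin.le_def.2 (by omega)
  have hrest : ∀ p ∉ C, x p = θ →
      ∃ i, JoinedIn {q | x q = θ ∧ q ∉ C} p (diagCell i) := by
    intro p hp hpθ
    have hge : θ ≤ ℓ p.1.2 := not_lt.1 fun h => hp ⟨hpθ, h⟩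
    have hle : (p.1.2 : ℕ) ≤ p.1.1 := p.2
    refine ⟨p.1.2, (joinedIn_column (p := diagCell p.1.2) (q := p) rfl hle fun r hr1 hr2 hr3 => ?_).symm⟩
    have hr1' : r.1.2 = p.1.2 := Fin.ext hr1
    refine ⟨le_antisymm (hpθ ▸ hx.le_of_le hr3 hr1.le) ?_, fun h => ?_⟩
    · exact hge.trans (hr1' ▸ hx.diag_col_le r)
    · have h2 : ℓ r.1.2 < θ := h.2
      rw [hr1'] at h2
      exact absurd h2 (not_lt.2 hge)
  obtain ⟨y, hy, hstep, hyC, hyC'⟩ :=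
    hx.exists_pushdown (C := C) (θ := θ) (fun p hp => hp.1) hconn hdiag hlow hrest
  refine ⟨y, hy, hstep, fun p hp => ?_, fun p hp => hyC' p fun h => hp h.1, fun p => ?_⟩
  · have hpC : p ∉ C := fun h => (hyC p h).ne hp
    rw [hyC' p hpC] at hp
    exact le_antisymm (hp ▸ hx.diag_col_le p) (not_lt.1 fun h => hpC ⟨hp, h⟩)
  · by_cases hpC : p ∈ C
    · rw [hpC.1]
      exact (hyC p hpC).le
    · exact (hyC' p hpC).le

/-- If the largest entry `κ` occurs once on the diagonal, one step makes its level sets agree. -/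
theorem IsVertexArray.exists_align {α : Type*} [LinearOrder α] {ℓ : Fin n → α} {κ : α}
    (hκ : ∀ i, ℓ i ≤ κ) (hκ' : ∀ i : Fin n, ℓ i = κ → (i : ℕ) + 1 = n)
    {x y : TriangleIndex n → α} (hx : IsVertexArray ℓ x) (hy : IsVertexArray ℓ y)
    (hxy : ∀ p, y p = κ → x p = κ) :
    ∃ z, IsVertexArray ℓ z ∧ IsStep x z ∧ ∀ p, z p = κ ↔ y p = κ := by
  have hxκ : ∀ p, x p ≤ κ := fun p => (hx.le_diag_row p).trans (hκ _)
  have hyκ : ∀ p, y p ≤ κ := fun p => (hy.le_diag_row p).trans (hκ _)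
  -- A row containing `κ` has diagonal entry `κ`, so it is the last row.
  have hlast : ∀ p, x p = κ → (p.1.1 : ℕ) + 1 = n := fun p hp =>
    hκ' _ (le_antisymm (hκ _) (hp ▸ hx.le_diag_row p))
  let C : Set (TriangleIndex n) := {p | x p = κ ∧ y p ≠ κ}
  have hrow : ∀ p ∈ C, ∀ q ∈ C, (p.1.2 : ℕ) ≤ q.1.2 → JoinedIn C p q := by
    intro p hp q hq hle
    have h1 := hlast p hp.1
    have h2 := hlast q hq.1
    refine joinedIn_row (by omega) hle fun r hr1 hr2 hr3 => ⟨le_antisymm (hxκ r) ?_, fun h => ?_⟩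
    · exact hp.1 ▸ hx.le_of_le hr1.ge hr2
    · exact hq.2 (le_antisymm (hyκ q) (h ▸ hy.le_of_le (by omega) hr3))
  have hconn : ∀ p ∈ C, ∀ q ∈ C, JoinedIn C p q := by
    intro p hp q hq
    rcases le_total (p.1.2 : ℕ) q.1.2 with h | h
    · exact hrow p hp q hq h
    · exact (hrow q hq p hp h).symm
  have hdiag : ∀ i, diagCell i ∉ C := by
    intro i hi
    have h1 : x (diagCell i) = κ := hi.1
    have h2 : y (diagCell i) ≠ κ := hi.2
    rw [hx.diag] at h1
    rw [hy.diag] at h2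
    exact h2 h1
  have hlow : ∀ p q, Covers p q → p ∉ C → q ∈ C → x p < κ := by
    intro p q hpq hp hq
    refine lt_of_le_of_ne (hxκ p) fun h => hp ⟨h, fun h' => hq.2 ?_⟩
    exact le_antisymm (hyκ q) (h' ▸ hy.mono p q hpq)
  have hrest : ∀ p ∉ C, x p = κ →
      ∃ i, JoinedIn {q | x q = κ ∧ q ∉ C} p (diagCell i) := by
    intro p hp hpκ
    have hyp : y p = κ := by_contra fun h => hp ⟨hpκ, h⟩
    refine ⟨p.1.1, joinedIn_row (q := diagCell p.1.1) rfl p.2 fun r hr1 hr2 _ => ?_⟩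
    have hyr : y r = κ := le_antisymm (hyκ r) (hyp ▸ hy.le_of_le hr1.ge hr2)
    exact ⟨hxy r hyr, fun h => h.2 hyr⟩
  obtain ⟨z, hz, hstep, hzC, hzC'⟩ :=
    hx.exists_pushdown (C := C) (θ := κ) (fun p hp => hp.1) hconn hdiag hlow hrest
  refine ⟨z, hz, hstep, fun p => ?_⟩
  by_cases hp : p ∈ C
  · exact ⟨fun h => absurd h (hzC p hp).ne, fun h => absurd h hp.2⟩
  · rw [hzC' p hp]
    exact ⟨fun h => by_contra fun h' => hp ⟨h, h'⟩, hxy p⟩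

/-- Both level sets of `κ` are terminal segments of the last row, hence nested. -/
theorem subset_or_subset_of_last {α : Type*} [LinearOrder α] {ℓ : Fin n → α} {κ : α}
    (hκ : ∀ i, ℓ i ≤ κ) (hκ' : ∀ i : Fin n, ℓ i = κ → (i : ℕ) + 1 = n)
    {x y : TriangleIndex n → α} (hx : IsArray ℓ x) (hy : IsArray ℓ y) :
    (∀ p, y p = κ → x p = κ) ∨ ∀ p, x p = κ → y p = κ := by
  have hlast : ∀ x : TriangleIndex n → α, IsArray ℓ x → ∀ p, x p = κ → (p.1.1 : ℕ) + 1 = n :=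
    fun x hx p hp => hκ' _ (le_antisymm (hκ _) (hp ▸ hx.le_diag_row p))
  by_contra! h
  obtain ⟨⟨p, hp, hp'⟩, q, hq, hq'⟩ := h
  have h1 := hlast y hy p hp
  have h2 := hlast x hx q hq
  rcases le_total (p.1.2 : ℕ) q.1.2 with h | h
  · exact hq' (le_antisymm ((hy.le_diag_row q).trans (hκ _)) (hp ▸ hy.le_of_le (by omega) h))
  · exact hp' (le_antisymm ((hx.le_diag_row p).trans (hκ _)) (hq ▸ hx.le_of_le (by omega) h))

/-- Arrays that agree off the first column and take two values there differ by a step. -/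
theorem isStep_of_firstColumn {α : Type*} [LinearOrder α] {ℓ : Fin n → α}
    {x y : TriangleIndex n → α} (hx : IsArray ℓ x) (hy : IsArray ℓ y) {a b : α} (hab : a < b)
    (h : ∀ p, x p ≠ y p → (p.1.2 : ℕ) = 0 ∧ (x p = a ∨ x p = b) ∧ (y p = a ∨ y p = b)) :
    IsStep x y := by
  have key : ∀ p q : TriangleIndex n, x p ≠ y p → x q ≠ y q → (p.1.1 : ℕ) ≤ q.1.1 →
      x p = x q ∧ y p = y q := by
    intro p q hp hq hle
    obtain ⟨h1, h2, h3⟩ := h p hp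
    obtain ⟨h4, h5, h6⟩ := h q hq
    have hxle := hx.le_of_le hle (by omega : (p.1.2 : ℕ) ≤ q.1.2)
    have hyle := hy.le_of_le hle (by omega : (p.1.2 : ℕ) ≤ q.1.2)
    -- At both cells the pair of values is `(a, b)` or `(b, a)`; a switch between these would
    -- decrease an entry on the way down.
    grind
  have conn : ∀ p q : TriangleIndex n, x p ≠ y p → x q ≠ y q → (p.1.1 : ℕ) ≤ q.1.1 →
      JoinedIn {r | x r ≠ y r} p q := by
    intro p q hp hq hle
    obtain ⟨e1, e2⟩ := key p q hp hq hle
    have c1 := (h p hp).1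
    have c2 := (h q hq).1
    refine joinedIn_column (by omega) hle fun r hr1 hr2 hr3 => ?_
    have hxr : x r = x p := le_antisymm (e1 ▸ hx.le_of_le hr3 (by omega))
      (hx.le_of_le hr2 (by omega))
    have hyr : y r = y p := le_antisymm (e2 ▸ hy.le_of_le hr3 (by omega))
      (hy.le_of_le hr2 (by omega))
    show x r ≠ y r
    rw [hxr, hyr]
    exact hp
  refine ⟨?_, fun p q hp hq => ?_⟩
  · by_cases hD : ∃ p, x p ≠ y p
    · obtain ⟨p, hp⟩ := hD
      refine ⟨x p, y p, fun q hq => ?_⟩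
      rcases le_total (p.1.1 : ℕ) q.1.1 with hle | hle
      · exact ⟨(key p q hp hq hle).1.symm, (key p q hp hq hle).2.symm⟩
      · exact key q p hq hp hle
    · exact ⟨a, a, fun p hp => absurd ⟨p, hp⟩ hD⟩
  · rcases le_total (p.1.1 : ℕ) q.1.1 with hle | hle
    · exact conn p q hp hq hle
    · exact (conn q p hq hp hle).symm

theorem IsVertexArray.exists_eq_diag {α : Type*} [LE α] {ℓ : Fin n → α} {x : TriangleIndex n → α}
    (hx : IsVertexArray ℓ x) (p : TriangleIndex n) : ∃ i, x p = ℓ i := by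
  obtain ⟨i, hi⟩ := hx.joined p
  exact ⟨i, (Eq.symm (hi.mem rfl : x (diagCell i) = x p)).trans (hx.diag i)⟩

theorem edist_le_one_of_isStep {lam : Fin n → ℕ}
    {u v : {v : TriangleIndex n → ℝ // IsExposed ℝ (gtPolytope lam) {v}}} (h : IsStep u.1 v.1) :
    (oneSkeleton (gtPolytope lam)).edist u v ≤ 1 := by
  rw [SimpleGraph.edist_le_one_iff_adj_or_eq]
  by_cases huv : u = v
  · exact .inr huv
  · exact .inl (adj_of_isStep huv h)

/-! ### Upper bound for distances -/

section UpperBound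

variable {lam : Fin n → ℕ} {ℓ : ℕ → ℕ} {C : ℕ → ℕ}

/-- Lowering `d` levels one after the other, starting with the one below `hi`. -/
theorem exists_descend (hℓ : Monotone ℓ) (hC : StrictMono C) (hlam : ∀ i : Fin n, lam i = C (ℓ i))
    (hi d : ℕ) (hd : d ≤ hi) (u : {v : TriangleIndex n → ℝ // IsExposed ℝ (gtPolytope lam) {v}}) :
    ∃ v, (oneSkeleton (gtPolytope lam)).edist u v ≤ d ∧
      (∀ p, (C (hi - d) : ℝ) ≤ v.1 p → v.1 p < C hi → v.1 p = lam p.1.2) ∧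
      ∀ p, (C hi : ℝ) ≤ u.1 p ∨ (C hi : ℝ) ≤ v.1 p → u.1 p = v.1 p := by
  have hmono : Monotone fun i : Fin n => (lam i : ℝ) := fun i j hij => by
    simp only [hlam, Nat.cast_le]
    exact hC.monotone (hℓ hij)
  induction d with
  | zero =>
    refine ⟨u, by simp, fun p h1 h2 => absurd h1 (not_le.2 h2), fun _ _ => rfl⟩
  | succ d ih =>
    obtain ⟨v, hv1, hv2, hv3⟩ := ih (by omega)
    have hv := isVertexArray_of_isExposed v.2
    obtain ⟨y, hy, hstep, hy1, hy2, hy3⟩ := hv.exists_settle hmono (C (hi - (d + 1)) : ℝ)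
    have hθ : (C (hi - (d + 1)) : ℝ) < C hi := by
      exact_mod_cast hC (show hi - (d + 1) < hi by omega)
    refine ⟨⟨y, isExposed_of_isVertexArray hy⟩, ?_, fun p h1 h2 => ?_, fun p hp => ?_⟩
    · refine (SimpleGraph.edist_triangle (v := v)).trans ?_
      push_cast
      exact add_le_add hv1 (edist_le_one_of_isStep hstep)
    · simp only at h1 h2 ⊢
      by_cases hyp : y p = C (hi - (d + 1))
      · rw [hyp, ← hy1 p hyp]
      · have hlt := lt_of_le_of_ne h1 (Ne.symm hyp)
        have hne : v.1 p ≠ C (hi - (d + 1)) := fun h => by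
          have := hy3 p
          rw [h] at this
          exact absurd hlt (not_lt.2 this)
        rw [hy2 p hne] at h2 hlt ⊢
        refine hv2 p ?_ h2
        -- Entries of a vertex are parts, so exceeding level `hi - (d + 1)` means having level at
        -- least `hi - d`.
        obtain ⟨i, hi'⟩ := hv.exists_eq_diag p
        rw [hi', hlam] at hlt ⊢
        have : hi - (d + 1) < ℓ i := hC.lt_iff_lt.1 (by exact_mod_cast hlt)
        exact_mod_cast hC.monotone (show hi - d ≤ ℓ i by omega)
    · simp only at hp ⊢
      have key : (C hi : ℝ) ≤ v.1 p → u.1 p = y p := fun h => by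
        rw [hy2 p (hθ.trans_le h).ne']
        exact hv3 p (.inr h)
      rcases hp with h | h
      · exact key (hv3 p (.inl h) ▸ h)
      · exact key (h.trans (hy3 p))

/-- Lowering the levels `hi - 1, …, 1` from both ends leads to the same vertex; level 0 needs no
lowering. -/
theorem edist_le_of_top_eq (hℓ : Monotone ℓ) (hC : StrictMono C)
    (hlam : ∀ i : Fin n, lam i = C (ℓ i)) {hi : ℕ} (hhi : 1 ≤ hi)
    {u v : {v : TriangleIndex n → ℝ // IsExposed ℝ (gtPolytope lam) {v}}}
    (huv : ∀ p, (C hi : ℝ) ≤ u.1 p ∨ (C hi : ℝ) ≤ v.1 p → u.1 p = v.1 p) :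
    (oneSkeleton (gtPolytope lam)).edist u v ≤ (2 * (hi - 1) : ℕ) := by
  obtain ⟨u', hu1, hu2, hu3⟩ := exists_descend hℓ hC hlam hi (hi - 1) (by omega) u
  obtain ⟨v', hv1, hv2, hv3⟩ := exists_descend hℓ hC hlam hi (hi - 1) (by omega) v
  rw [show hi - (hi - 1) = 1 by omega] at hu2 hv2
  have hlow : ∀ w : {v : TriangleIndex n → ℝ // IsExposed ℝ (gtPolytope lam) {v}},
      (∀ p, (C 1 : ℝ) ≤ w.1 p → w.1 p < C hi → w.1 p = lam p.1.2) →
      ∀ p, w.1 p < C hi → w.1 p = lam p.1.2 := by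
    intro w hw p hp
    by_cases h1 : (C 1 : ℝ) ≤ w.1 p
    · exact hw p h1 hp
    · have hwv := isVertexArray_of_isExposed w.2
      obtain ⟨i, hi'⟩ := hwv.exists_eq_diag p
      have hcol := hwv.diag_col_le p
      rw [hi', hlam] at h1
      rw [hi'] at hcol ⊢
      refine le_antisymm ?_ hcol
      have : ℓ i < 1 := hC.lt_iff_lt.1 (by exact_mod_cast not_le.1 h1)
      rw [hlam, hlam, show ℓ i = 0 by omega]
      exact_mod_cast hC.monotone (Nat.zero_le _)
  have huv' : u' = v' := by
    refine Subtype.ext (funext fun p => ?_)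
    by_cases h1 : (C hi : ℝ) ≤ u.1 p
    · have h2 := huv p (.inl h1)
      rw [← hu3 p (.inl h1), ← hv3 p (.inl (h2 ▸ h1)), h2]
    · have h2 : ¬ (C hi : ℝ) ≤ v.1 p := fun h => h1 ((huv p (.inr h)).symm ▸ h)
      have h3 : ¬ (C hi : ℝ) ≤ u'.1 p := fun h => h1 ((hu3 p (.inr h)).symm ▸ h)
      have h4 : ¬ (C hi : ℝ) ≤ v'.1 p := fun h => h2 ((hv3 p (.inr h)).symm ▸ h)
      rw [hlow u' hu2 p (not_le.1 h3), hlow v' hv2 p (not_le.1 h4)]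
  subst huv'
  refine (SimpleGraph.edist_triangle (v := u')).trans ?_
  rw [SimpleGraph.edist_comm (u := u') (v := v), two_mul]
  push_cast
  exact add_le_add hu1 hv1

/-- Lowering stops at level 2. Below level `hi`, an entry can then differ from the diagonal entry of
its column only by being 1 instead of 0 in level, in the first column; a single step replaces the
two lowerings of level 1. -/
theorem edist_le_of_top_eq_of_first (hℓ : Monotone ℓ) (hC : StrictMono C)
    (hlam : ∀ i : Fin n, lam i = C (ℓ i)) (hfirst : ∀ i : Fin n, ℓ i = 0 → (i : ℕ) = 0) {hi : ℕ}
    (hhi : 2 ≤ hi) {u v : {v : TriangleIndex n → ℝ // IsExposed ℝ (gtPolytope lam) {v}}}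
    (huv : ∀ p, (C hi : ℝ) ≤ u.1 p ∨ (C hi : ℝ) ≤ v.1 p → u.1 p = v.1 p) :
    (oneSkeleton (gtPolytope lam)).edist u v ≤ (2 * (hi - 2) + 1 : ℕ) := by
  obtain ⟨u', hu1, hu2, hu3⟩ := exists_descend hℓ hC hlam hi (hi - 2) (by omega) u
  obtain ⟨v', hv1, hv2, hv3⟩ := exists_descend hℓ hC hlam hi (hi - 2) (by omega) v
  rw [show hi - (hi - 2) = 2 by omega] at hu2 hv2
  have hlow : ∀ w : {v : TriangleIndex n → ℝ // IsExposed ℝ (gtPolytope lam) {v}},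
      (∀ p, (C 2 : ℝ) ≤ w.1 p → w.1 p < C hi → w.1 p = lam p.1.2) →
      ∀ p, w.1 p < C hi → w.1 p = lam p.1.2 ∨
        ((p.1.2 : ℕ) = 0 ∧ lam p.1.2 = C 0 ∧ w.1 p = C 1) := by
    intro w hw p hp
    by_cases h1 : (C 2 : ℝ) ≤ w.1 p
    · exact .inl (hw p h1 hp)
    · have hwv := isVertexArray_of_isExposed w.2
      obtain ⟨i, hi'⟩ := hwv.exists_eq_diag p
      have hcol := hwv.diag_col_le p
      rw [hi', hlam] at h1
      rw [hi'] at hcol ⊢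
      have h2 : ℓ i < 2 := hC.lt_iff_lt.1 (by exact_mod_cast not_le.1 h1)
      rw [hlam, hlam] at hcol
      have h3 : ℓ p.1.2 ≤ ℓ i := hC.le_iff_le.1 (by exact_mod_cast hcol)
      rw [hlam, hlam]
      by_cases h4 : ℓ p.1.2 = ℓ i
      · exact .inl (by rw [h4])
      · exact .inr ⟨hfirst _ (by omega), by rw [show ℓ p.1.2 = 0 by omega],
          by rw [show ℓ i = 1 by omega]⟩
  have hstep : IsStep u'.1 v'.1 := by
    refine isStep_of_firstColumn (isVertexArray_of_isExposed u'.2).toIsArray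
      (isVertexArray_of_isExposed v'.2).toIsArray (a := (C 0 : ℝ)) (b := (C 1 : ℝ))
      (by exact_mod_cast hC Nat.zero_lt_one) fun p hp => ?_
    by_cases h1 : (C hi : ℝ) ≤ u.1 p
    · have h2 := huv p (.inl h1)
      exact absurd ((hu3 p (.inl h1)).symm.trans (h2.trans (hv3 p (.inl (h2 ▸ h1))))) hp
    · have h2 : ¬ (C hi : ℝ) ≤ v.1 p := fun h => h1 ((huv p (.inr h)).symm ▸ h)
      have h3 : ¬ (C hi : ℝ) ≤ u'.1 p := fun h => h1 ((hu3 p (.inr h)).symm ▸ h)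
      have h4 : ¬ (C hi : ℝ) ≤ v'.1 p := fun h => h2 ((hv3 p (.inr h)).symm ▸ h)
      rcases hlow u' hu2 p (not_le.1 h3) with e1 | ⟨e0, e1, e2⟩ <;>
        rcases hlow v' hv2 p (not_le.1 h4) with f1 | ⟨f0, f1, f2⟩
      · exact absurd (e1.trans f1.symm) hp
      · exact ⟨f0, .inl (by rw [e1, f1]), .inr f2⟩
      · exact ⟨e0, .inr e2, .inl (by rw [f1, e1])⟩
      · exact absurd (e2.trans f2.symm) hp
  refine (SimpleGraph.edist_triangle (v := u')).trans ?_
  refine (add_le_add hu1 (SimpleGraph.edist_triangle (v := v'))).trans ?_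
  rw [SimpleGraph.edist_comm (u := v') (v := v)]
  refine (add_le_add le_rfl (add_le_add (edist_le_one_of_isStep hstep) hv1)).trans (le_of_eq ?_)
  push_cast
  ring

/-- If the largest part is simple, one step makes the top level sets of two vertices agree. -/
theorem edist_le_succ_of_last (hC : StrictMono C) (hlam : ∀ i : Fin n, lam i = C (ℓ i)) {L D : ℕ}
    (hL : ∀ i : Fin n, ℓ i ≤ L) (hlast : ∀ i : Fin n, ℓ i = L → (i : ℕ) + 1 = n)
    (hD : ∀ u v : {v : TriangleIndex n → ℝ // IsExposed ℝ (gtPolytope lam) {v}},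
      (∀ p, (C L : ℝ) ≤ u.1 p ∨ (C L : ℝ) ≤ v.1 p → u.1 p = v.1 p) →
      (oneSkeleton (gtPolytope lam)).edist u v ≤ D)
    (u v : {v : TriangleIndex n → ℝ // IsExposed ℝ (gtPolytope lam) {v}}) :
    (oneSkeleton (gtPolytope lam)).edist u v ≤ (D + 1 : ℕ) := by
  have hκ : ∀ i, (lam i : ℝ) ≤ C L := fun i => by
    rw [hlam]; exact_mod_cast hC.monotone (hL i)
  have hκ' : ∀ i : Fin n, (lam i : ℝ) = C L → (i : ℕ) + 1 = n := fun i h => by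
    rw [hlam] at h
    exact hlast i (hC.injective (by exact_mod_cast h))
  have main : ∀ u v : {v : TriangleIndex n → ℝ // IsExposed ℝ (gtPolytope lam) {v}},
      (∀ p, v.1 p = C L → u.1 p = C L) →
      (oneSkeleton (gtPolytope lam)).edist u v ≤ (D + 1 : ℕ) := by
    intro u v huv
    have hv := isVertexArray_of_isExposed v.2
    obtain ⟨z, hz, hstep, hzv⟩ :=
      (isVertexArray_of_isExposed u.2).exists_align hκ hκ' hv huv
    have hzκ : ∀ p, z p ≤ C L := fun p => (hz.le_diag_row p).trans (hκ _)
    have hvκ : ∀ p, v.1 p ≤ C L := fun p => (hv.le_diag_row p).trans (hκ _)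
    refine (SimpleGraph.edist_triangle (v := ⟨z, isExposed_of_isVertexArray hz⟩)).trans ?_
    rw [add_comm]
    push_cast
    refine add_le_add (hD _ _ fun p hp => ?_) (edist_le_one_of_isStep hstep)
    simp only at hp ⊢
    rcases hp with hp | hp
    · have h1 := le_antisymm (hzκ p) hp
      rw [h1, (hzv p).1 h1]
    · have h1 := le_antisymm (hvκ p) hp
      rw [h1, (hzv p).2 h1]
  rcases subset_or_subset_of_last hκ hκ' (isVertexArray_of_isExposed u.2).toIsArray
    (isVertexArray_of_isExposed v.2).toIsArray with h | h
  · exact main u v h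
  · rw [SimpleGraph.edist_comm]
    exact main v u h

end UpperBound

/-! ### Two distant vertices -/

section LowerBound

/-- Moving right when `i + j` is even and up when it is odd keeps `⌊(i + j) / 2⌋` and approaches the
diagonal. -/
theorem isVertexArray_floor {α : Type*} [Preorder α] {ℓ : ℕ → α} (hℓ : Monotone ℓ) :
    IsVertexArray (fun i : Fin n => ℓ i) fun p => ℓ ((p.1.1 + p.1.2) / 2) := by
  refine ⟨⟨fun i => ?_, fun p q hpq => hℓ ?_⟩, fun p => ?_⟩
  · simp only [diagCell]
    congr 1
    omega
  · simp only [Covers, Fin.ext_iff] at hpq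
    omega
  · have key : ∀ d, ∀ p : TriangleIndex n, (p.1.1 : ℕ) = p.1.2 + d →
        ∃ i, JoinedIn {q | ((q.1.1 : ℕ) + q.1.2) / 2 = (p.1.1 + p.1.2) / 2} p (diagCell i) := by
      intro d
      induction d with
      | zero => exact fun p hp => ⟨p.1.1, by
          rw [show diagCell p.1.1 = p from TriangleIndex.ext_val rfl hp]
          exact .refl⟩
      | succ d ih =>
        intro p hp
        have hpn := p.1.1.2
        have hstep : ∃ q : TriangleIndex n, (q.1.1 : ℕ) = q.1.2 + d ∧ Nbr p q ∧
            ((q.1.1 : ℕ) + q.1.2) / 2 = (p.1.1 + p.1.2) / 2 := by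
          rcases Nat.even_or_odd' ((p.1.1 : ℕ) + p.1.2) with ⟨c, hc | hc⟩
          · exact ⟨cell p.1.1 (p.1.2 + 1) (by omega) (by omega), by simp [cell]; omega,
              .inl (.inr ⟨rfl, rfl⟩), by simp [cell]; omega⟩
          · exact ⟨cell (p.1.1 - 1) p.1.2 (by omega) (by omega), by simp [cell]; omega,
              .inr (.inl ⟨by simp [cell]; omega, rfl⟩), by simp [cell]; omega⟩
        obtain ⟨q, h1, h2, h3⟩ := hstep
        obtain ⟨i, hi⟩ := ih q h1
        rw [h3] at hi
        exact ⟨i, .head ⟨h2, rfl, h3⟩ hi⟩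
    obtain ⟨i, hi⟩ := key (p.1.1 - p.1.2) p (by
      have : (p.1.2 : ℕ) ≤ p.1.1 := p.2
      omega)
    exact ⟨i, hi.mono fun q hq => congrArg ℓ hq⟩

theorem isVertexArray_ceil {α : Type*} [Preorder α] {ℓ : ℕ → α} (hℓ : Monotone ℓ) :
    IsVertexArray (fun i : Fin n => ℓ i) fun p => ℓ ((p.1.1 + p.1.2 + 1) / 2) := by
  refine ⟨⟨fun i => ?_, fun p q hpq => hℓ ?_⟩, fun p => ?_⟩
  · simp only [diagCell]
    congr 1
    omega
  · simp only [Covers, Fin.ext_iff] at hpq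
    omega
  · have key : ∀ d, ∀ p : TriangleIndex n, (p.1.1 : ℕ) = p.1.2 + d →
        ∃ i, JoinedIn {q | ((q.1.1 : ℕ) + q.1.2 + 1) / 2 = (p.1.1 + p.1.2 + 1) / 2} p
          (diagCell i) := by
      intro d
      induction d with
      | zero => exact fun p hp => ⟨p.1.1, by
          rw [show diagCell p.1.1 = p from TriangleIndex.ext_val rfl hp]
          exact .refl⟩
      | succ d ih =>
        intro p hp
        have hpn := p.1.1.2
        have hstep : ∃ q : TriangleIndex n, (q.1.1 : ℕ) = q.1.2 + d ∧ Nbr p q ∧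
            ((q.1.1 : ℕ) + q.1.2 + 1) / 2 = (p.1.1 + p.1.2 + 1) / 2 := by
          rcases Nat.even_or_odd' ((p.1.1 : ℕ) + p.1.2) with ⟨c, hc | hc⟩
          · exact ⟨cell (p.1.1 - 1) p.1.2 (by omega) (by omega), by simp [cell]; omega,
              .inr (.inl ⟨by simp [cell]; omega, rfl⟩), by simp [cell]; omega⟩
          · exact ⟨cell p.1.1 (p.1.2 + 1) (by omega) (by omega), by simp [cell]; omega,
              .inl (.inr ⟨rfl, rfl⟩), by simp [cell]; omega⟩
        obtain ⟨q, h1, h2, h3⟩ := hstep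
        obtain ⟨i, hi⟩ := ih q h1
        rw [h3] at hi
        exact ⟨i, .head ⟨h2, rfl, h3⟩ hi⟩
    obtain ⟨i, hi⟩ := key (p.1.1 - p.1.2) p (by
      have : (p.1.2 : ℕ) ≤ p.1.1 := p.2
      omega)
    exact ⟨i, hi.mono fun q hq => congrArg ℓ hq⟩

theorem IsTransit.one_add_changes_merge_le {ℓ : ℕ → ℕ} {L N : ℕ} {X : ℕ → TriangleIndex n → ℕ}
    (hℓ : IsLevelSeq n L ℓ) (h : IsTransit n ℓ N X) {k : ℕ} (hk : k < L) :
    1 + changes (fun t => merge k 1 ∘ X t) N ≤ changes X N := by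
  obtain ⟨s, hs, h1, h2⟩ := hℓ.exists_jump hk
  obtain ⟨t, ht, m1, m2⟩ := h.exists_move hs h1 h2
  have := card_add_changes_comp_le h.step (merge k 1) {t} fun t' ht' => by
    rw [Finset.mem_singleton.1 ht']
    exact ⟨ht, k, k + 1, by omega, by unfold merge; omega, _, m1, m2⟩
  simpa using this

/-- The number of changes needed, allowing for simple first and last parts. -/
theorem IsTransit.le_changes {ℓ : ℕ → ℕ} {L N : ℕ} {X : ℕ → TriangleIndex n → ℕ}
    (hℓ : IsLevelSeq n L ℓ) (h : IsTransit n ℓ N X) (hn : 2 ≤ n)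
    (hL : 2 ≤ L ∨ ℓ 1 = 0 ∨ ℓ (n - 2) = L) :
    2 * L ≤ changes X N + (if ℓ 1 = 0 then 0 else 1) + (if ℓ (n - 2) = L then 0 else 1) := by
  have hℓ1 : ℓ 1 ≤ 1 := by
    have := hℓ.succ_le 0
    rw [hℓ.zero] at this
    simpa using this
  have hℓn : ℓ (n - 2) ≤ L ∧ L ≤ ℓ (n - 2) + 1 := by
    have h1 := hℓ.succ_le (n - 2)
    have h2 := hℓ.mono (Nat.le_succ (n - 2))
    rw [Nat.succ_eq_add_one, show n - 2 + 1 = n - 1 by omega, hℓ.last] at h2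
    rw [show n - 2 + 1 = n - 1 by omega, hℓ.last] at h1
    exact ⟨h2, h1⟩
  have hL1 : ℓ 1 ≤ L := by
    have := hℓ.mono (show 1 ≤ n - 1 by omega)
    rwa [hℓ.last] at this
  by_cases hf : ℓ 1 = 0 <;> by_cases hl : ℓ (n - 2) = L
  · have := h.two_mul_le_changes hℓ hf hl hn
    omega
  · have h1 := h.one_add_changes_merge_le hℓ (k := L - 1) (by omega)
    have h2 := (h.comp (merge_monotone (L - 1) 1)).two_mul_le_changes
      (hℓ.merge (by omega)) (by simp [merge, hf])
      (by simp only [merge, Function.comp_apply]; omega) hn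
    simp only [hf, hl, if_true, if_false]
    omega
  · have h1 := h.one_add_changes_merge_le hℓ (k := 0) (by omega)
    have h2 := (h.comp (merge_monotone 0 1)).two_mul_le_changes
      (hℓ.merge (by omega)) (by simp only [merge, Function.comp_apply]; omega)
      (by simp only [merge, Function.comp_apply]; omega) hn
    simp only [hf, hl, if_true, if_false]
    omega
  · have hL2 : 2 ≤ L := by tauto
    have h' := h.comp (merge_monotone 0 1)
    have hℓ' := hℓ.merge (k := 0) (d := 1) (by omega)
    have h1 := h.one_add_changes_merge_le hℓ (k := 0) (by omega)
    have h2 := h'.one_add_changes_merge_le hℓ' (k := L - 2) (by omega)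
    have h3 := (h'.comp (merge_monotone (L - 2) 1)).two_mul_le_changes
      (hℓ'.merge (by omega)) (by simp only [merge, Function.comp_apply]; omega)
      (by simp only [merge, Function.comp_apply]; omega) hn
    simp only [hf, hl, if_false]
    omega

/-- The level of a real entry is read off by counting the values `C k` below it; monotonicity on all
of `ℝ` lets vertex arrays be transported. -/
theorem exists_monotone_leftInverse {C : ℕ → ℕ} (hC : StrictMono C) (L : ℕ) :
    ∃ f : ℝ → ℕ, Monotone f ∧ ∀ k ≤ L, f (C k) = k := by
  classical
  refine ⟨fun r => ((Finset.range L).filter fun k => (C k : ℝ) < r).card, fun r r' hr => ?_,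
    fun k hk => ?_⟩
  · refine Finset.card_le_card fun k hk => ?_
    simp only [Finset.mem_filter] at hk ⊢
    exact ⟨hk.1, hk.2.trans_le hr⟩
  · have : ((Finset.range L).filter fun j => (C j : ℝ) < C k) = Finset.range k := by
      ext j
      simp only [Finset.mem_filter, Finset.mem_range, Nat.cast_lt, hC.lt_iff_lt]
      omega
    exact (congrArg Finset.card this).trans (Finset.card_range k)

theorem exists_le_edist {lam : Fin n → ℕ} {ℓ : ℕ → ℕ} {L : ℕ} {C : ℕ → ℕ}
    (hℓ : IsLevelSeq n L ℓ) (hC : StrictMono C) (hlam : ∀ i : Fin n, lam i = C (ℓ i)) (hn : 2 ≤ n)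
    (hL : 2 ≤ L ∨ ℓ 1 = 0 ∨ ℓ (n - 2) = L) {D : ℕ}
    (hD : D + (if ℓ 1 = 0 then 0 else 1) + (if ℓ (n - 2) = L then 0 else 1) ≤ 2 * L) :
    ∃ u v, (D : ℕ∞) ≤ (oneSkeleton (gtPolytope lam)).edist u v := by
  have hmono : Monotone fun k => (C (ℓ k) : ℝ) := fun a b hab => by
    simp only [Nat.cast_le]
    exact hC.monotone (hℓ.mono hab)
  have hlam' : (fun i : Fin n => (lam i : ℝ)) = fun i : Fin n => (C (ℓ i) : ℝ) :=
    funext fun i => by rw [hlam]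
  have hu := isVertexArray_floor (n := n) hmono
  have hv := isVertexArray_ceil (n := n) hmono
  rw [← hlam'] at hu hv
  refine ⟨⟨_, isExposed_of_isVertexArray hu⟩, ⟨_, isExposed_of_isVertexArray hv⟩, ?_⟩
  -- The distance is an infimum over walks, so bounding each walk suffices and connectedness is not
  -- needed.
  refine le_iInf fun w => ?_
  obtain ⟨f, hf, hfC⟩ := exists_monotone_leftInverse hC L
  have hle : ∀ k ≤ n - 1, f (C (ℓ k)) = ℓ k := fun k hk => hfC _ (hℓ.last ▸ hℓ.mono hk)
  have htr : IsTransit n ℓ w.length fun t => f ∘ (w.getVert t).1 := by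
    refine ⟨fun t _ => ?_, fun t ht => ?_, fun p => ?_, fun p => ?_⟩
    · have := (isVertexArray_of_isExposed (w.getVert t).2).comp hf
      have hfl : (f ∘ fun i : Fin n => (lam i : ℝ)) = fun i : Fin n => ℓ i := funext fun i => by
        simp only [Function.comp_apply, hlam]
        exact hle i (by omega)
      rwa [hfl] at this
    · exact (isStep_of_adj (w.adj_getVert_succ ht)).comp f
    · simp only [SimpleGraph.Walk.getVert_zero, Function.comp_apply]
      exact hle _ (by omega)
    · have hp : (p.1.2 : ℕ) ≤ p.1.1 := p.2
      simp only [SimpleGraph.Walk.getVert_length, Function.comp_apply]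
      exact hle _ (by omega)
  have h1 := htr.le_changes hℓ hn hL
  have h2 := changes_le (fun t => f ∘ (w.getVert t).1) w.length
  have : D ≤ w.length := by omega
  exact_mod_cast this

end LowerBound

/-! ### Levels of a sequence given by multiplicities -/

section BlockSeq

variable {m : ℕ} {a : Fin m → ℕ}

/-- The block boundaries of `finSigmaFinEquiv`. -/
theorem exists_blockBounds (a : Fin m → ℕ) :
    ∃ S : ℕ → ℕ, S 0 = 0 ∧ S m = ∑ i, a i ∧ (∀ i (hi : i < m), S (i + 1) = S i + a ⟨i, hi⟩) ∧
      ∀ k : Fin (∑ i, a i), S (finSigmaFinEquiv.symm k).1 ≤ k ∧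
        (k : ℕ) < S ((finSigmaFinEquiv.symm k).1 + 1) := by
  let b : ℕ → ℕ := fun i => if h : i < m then a ⟨i, h⟩ else 0
  have hS : ∀ i (hi : i < m), ∑ j ∈ Finset.range (i + 1), b j
      = ∑ j ∈ Finset.range i, b j + a ⟨i, hi⟩ := fun i hi => by
    rw [Finset.sum_range_succ]
    simp [b, hi]
  refine ⟨fun i => ∑ j ∈ Finset.range i, b j, by simp, ?_, hS, fun k => ?_⟩
  · simp only
    rw [← Fin.sum_univ_eq_sum_range]
    simp [b]
  · obtain ⟨⟨i, r⟩, rfl⟩ := finSigmaFinEquiv.surjective k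
    have hsum : ∑ j : Fin i, a (Fin.castLE i.2.le j) = ∑ j ∈ Finset.range i, b j := by
      rw [← Fin.sum_univ_eq_sum_range]
      refine Finset.sum_congr rfl fun j _ => ?_
      simp only [b]
      rw [dif_pos (j.2.trans i.2)]
      rfl
    have h1 := finSigmaFinEquiv_apply (⟨i, r⟩ : (i : Fin m) × Fin (a i))
    simp only [hsum] at h1
    simp only [Equiv.symm_apply_apply]
    rw [hS i i.2]
    have := r.2
    simp only [Fin.eta]
    omega

/-- The index of the block containing a position, extended beyond the last position. -/
def blockIndex (a : Fin m → ℕ) (k : ℕ) : ℕ :=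
  if h : k < ∑ i, a i then ((finSigmaFinEquiv (n := a)).symm ⟨k, h⟩).1 else m - 1

theorem blockIndex_facts (hm : 0 < m) (ha : ∀ i, 0 < a i) :
    IsLevelSeq (∑ i, a i) (m - 1) (blockIndex a) ∧
      (blockIndex a 1 = 0 ↔ m = 1 ∨ a ⟨0, hm⟩ ≠ 1) ∧
      (2 ≤ ∑ i, a i → (blockIndex a (∑ i, a i - 2) = m - 1 ↔
        m = 1 ∨ a ⟨m - 1, Nat.sub_one_lt_of_lt hm⟩ ≠ 1)) := by
  obtain ⟨S, hS0, hSm, hSs, hS⟩ := exists_blockBounds a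
  have hlt : ∀ i < m, S i < S (i + 1) := fun i hi => by
    have := ha ⟨i, hi⟩
    have := hSs i hi
    omega
  have hmono : ∀ i j, i ≤ j → j ≤ m → S i ≤ S j := by
    intro i j hij
    induction j, hij using Nat.le_induction with
    | base => exact fun _ => le_rfl
    | succ j _ ih => exact fun hj => (ih (by omega)).trans (hlt j (by omega)).le
  have hb : ∀ k, k < ∑ i, a i → blockIndex a k < m ∧ S (blockIndex a k) ≤ k ∧
      k < S (blockIndex a k + 1) := fun k hk => by
    rw [blockIndex, dif_pos hk]
    exact ⟨Fin.is_lt _, hS ⟨k, hk⟩⟩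
  have hb' : ∀ k, ¬ k < ∑ i, a i → blockIndex a k = m - 1 := fun k hk => by
    rw [blockIndex, dif_neg hk]
  have huniq : ∀ k i, k < ∑ i, a i → i < m → S i ≤ k → k < S (i + 1) → blockIndex a k = i := by
    intro k i hk hi h1 h2
    obtain ⟨h3, h4, h5⟩ := hb k hk
    rcases lt_trichotomy (blockIndex a k) i with h | h | h
    · have := hmono (blockIndex a k + 1) i h hi.le
      omega
    · exact h
    · have := hmono (i + 1) (blockIndex a k) h h3.le
      omega
  have hsum : 0 < ∑ i, a i := by
    have h1 := hlt 0 hm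
    have h2 := hmono 1 m hm le_rfl
    simp only [zero_add] at h1
    omega
  have hlast := hSs (m - 1) (by omega)
  rw [show m - 1 + 1 = m by omega, hSm] at hlast
  have hS1 := hSs 0 hm
  simp only [zero_add, hS0] at hS1
  have hlastpos := ha ⟨m - 1, Nat.sub_one_lt_of_lt hm⟩
  have hfirstpos := ha ⟨0, hm⟩
  refine ⟨⟨fun k k' hkk => ?_, ?_, fun k => ?_, ?_⟩, ?_, fun hn => ?_⟩
  · by_cases hk' : k' < ∑ i, a i
    · obtain ⟨h1, h2, h3⟩ := hb k (by omega)
      obtain ⟨h4, h5, h6⟩ := hb k' hk'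
      by_contra hcon
      have := hmono (blockIndex a k' + 1) (blockIndex a k) (by omega) (by omega)
      omega
    · rw [hb' k' hk']
      by_cases hk : k < ∑ i, a i
      · have := (hb k hk).1
        omega
      · exact (hb' k hk).le
  · exact huniq 0 0 hsum hm (by omega) (by simp only [zero_add]; omega)
  · by_cases hk : k + 1 < ∑ i, a i
    · obtain ⟨h1, h2, h3⟩ := hb k (by omega)
      obtain ⟨h4, h5, h6⟩ := hb (k + 1) hk
      by_contra hcon
      have h7 := hlt (blockIndex a k + 1) (by omega)
      have := hmono (blockIndex a k + 1 + 1) (blockIndex a (k + 1)) (by omega) (by omega)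
      omega
    · rw [hb' _ hk]
      by_cases hk' : k < ∑ i, a i
      · obtain ⟨h1, h2, h3⟩ := hb k hk'
        by_contra hcon
        have h7 := hlt (blockIndex a k + 1) (by omega)
        have := hmono (blockIndex a k + 1 + 1) m (by omega) le_rfl
        omega
      · rw [hb' k hk']
        omega
  · refine huniq _ _ (by omega) (by omega) (by omega) ?_
    rw [show m - 1 + 1 = m by omega]
    omega
  · by_cases h1 : 1 < ∑ i, a i
    · constructor
      · intro h
        have := (hb 1 h1).2.2
        rw [h, zero_add] at this
        omega
      · rintro (rfl | h)
        · have := (hb 1 h1).1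
          omega
        · exact huniq 1 0 h1 hm (by omega) (by simp only [zero_add]; omega)
    -- With a single position, position 1 is out of range and takes the default `m - 1`.
    · have h2 := hb' 1 h1
      rw [h2]
      by_cases hm1 : m = 1
      · simp [hm1]
      · have h3 := hmono 2 m (by omega) le_rfl
        have h4 := hlt 1 (by omega)
        simp only [Nat.reduceAdd] at h4
        omega
  · constructor
    · intro h
      have := (hb (∑ i, a i - 2) (by omega)).2.1
      rw [h] at this
      omega
    · rintro (rfl | h)
      · have := (hb (∑ i, a i - 2) (by omega)).1
        omega
      · refine huniq _ _ (by omega) (by omega) (by omega) ?_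
        rw [show m - 1 + 1 = m by omega]
        omega

/-- Values beyond the parts are arbitrary; they supply a threshold `C (L + 1)` above all entries. -/
theorem exists_strictMono_extension (hm : 0 < m) {c : Fin m → ℕ} (hc : StrictMono c) :
    ∃ C : ℕ → ℕ, StrictMono C ∧ ∀ i : Fin m, C i = c i := by
  refine ⟨fun k => c ⟨min k (m - 1), by omega⟩ + (k - (m - 1)), strictMono_nat_of_lt_succ fun k => ?_,
    fun i => ?_⟩
  · by_cases hk : k + 1 < m
    · have : c ⟨min k (m - 1), by omega⟩ < c ⟨min (k + 1) (m - 1), by omega⟩ :=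
        hc (Fin.lt_def.2 (by simp only; omega))
      omega
    · have : (⟨min (k + 1) (m - 1), by omega⟩ : Fin m) = ⟨min k (m - 1), by omega⟩ :=
        Fin.ext (by simp only; omega)
      rw [this]
      omega
  · have : (⟨min i (m - 1), by omega⟩ : Fin m) = i := Fin.ext (by simp only; omega)
    simp only [this]
    omega

end BlockSeq

/-! ### The diameter -/

/-- Distances in the skeleton, in terms of the levels of the diagonal. -/
theorem edist_le {n L : ℕ} {lam : Fin n → ℕ} {ℓ : ℕ → ℕ} {C : ℕ → ℕ} (hℓ : IsLevelSeq n L ℓ)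
    (hC : StrictMono C) (hlam : ∀ i : Fin n, lam i = C (ℓ i)) (hn : 2 ≤ n)
    (hL : 2 ≤ L ∨ ℓ 1 = 0 ∨ ℓ (n - 2) = L) {D : ℕ}
    (hD : 2 * L ≤ D + (if ℓ 1 = 0 then 0 else 1) + (if ℓ (n - 2) = L then 0 else 1))
    (u v : {v : TriangleIndex n → ℝ // IsExposed ℝ (gtPolytope lam) {v}}) :
    (oneSkeleton (gtPolytope lam)).edist u v ≤ D := by
  have hle : ∀ i : Fin n, ℓ i ≤ L := fun i => hℓ.last ▸ hℓ.mono (by omega)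
  -- No entry reaches level `L + 1`, so agreement above it is vacuous.
  have htop : ∀ p, (C (L + 1) : ℝ) ≤ u.1 p ∨ (C (L + 1) : ℝ) ≤ v.1 p → u.1 p = v.1 p := by
    have hlt : ∀ w : {v : TriangleIndex n → ℝ // IsExposed ℝ (gtPolytope lam) {v}}, ∀ p,
        w.1 p < C (L + 1) := fun w p => by
      refine ((isVertexArray_of_isExposed w.2).le_diag_row p).trans_lt ?_
      rw [hlam]
      exact_mod_cast hC (Nat.lt_succ_of_le (hle _))
    rintro p (h | h)
    · exact absurd h (not_le.2 (hlt u p))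
    · exact absurd h (not_le.2 (hlt v p))
  have hLpos : ℓ 1 ≤ L := hℓ.last ▸ hℓ.mono (by omega)
  have hLpos' : ℓ (n - 2) ≤ L := hℓ.last ▸ hℓ.mono (by omega)
  have hfirst : ¬ ℓ 1 = 0 → ∀ i : Fin n, ℓ i = 0 → (i : ℕ) = 0 := fun h i hi => by
    by_contra hne
    have := hℓ.mono (show 1 ≤ (i : ℕ) by omega)
    omega
  have hlast : ¬ ℓ (n - 2) = L → ∀ i : Fin n, ℓ i = L → (i : ℕ) + 1 = n := fun h i hi => by
    by_contra hne
    have := hℓ.mono (show (i : ℕ) ≤ n - 2 by omega)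
    omega
  have cast : ∀ {d : ℕ} {e : ℕ∞}, d ≤ D → e ≤ d → e ≤ D := fun hd he =>
    he.trans (by exact_mod_cast hd)
  by_cases hf : ℓ 1 = 0 <;> by_cases hl : ℓ (n - 2) = L <;>
    simp only [hf, hl, if_true, if_false] at hD
  · exact cast (by omega) (edist_le_of_top_eq hℓ.mono hC hlam (by omega) htop)
  · exact cast (by omega) (edist_le_succ_of_last hC hlam hle (hlast hl)
      (fun u v h => edist_le_of_top_eq hℓ.mono hC hlam (by omega) h) u v)
  · exact cast (by omega)
      (edist_le_of_top_eq_of_first hℓ.mono hC hlam (hfirst hf) (by omega) htop)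
  · exact cast (by omega) (edist_le_succ_of_last hC hlam hle (hlast hl)
      (fun u v h => edist_le_of_top_eq_of_first hℓ.mono hC hlam (hfirst hf) (by omega) h) u v)

end GelfandTsetlin

open GelfandTsetlin in
theorem theorem1p1 (m : ℕ) (hm : 0 < m)
    -- the distinct parts and their multiplicities
    (c a : Fin m → ℕ) (hc : StrictMono c) (hc_pos : ∀ i, 0 < c i) (ha : ∀ i, 0 < a i)
    -- `a` is neither `(1)` nor `(1, 1)`
    (h_small : 3 ≤ m ∨ ∃ i, a i ≠ 1) :
    (oneSkeleton (gtPolytope (blockSeq c a))).Connected ∧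
      (oneSkeleton (gtPolytope (blockSeq c a))).ediam ≠ ⊤ ∧
      ((oneSkeleton (gtPolytope (blockSeq c a))).diam : ℤ) =
        2 * (m : ℤ) - 2 - (if a ⟨0, hm⟩ = 1 then 1 else 0)
          - (if a ⟨m - 1, Nat.sub_one_lt_of_lt hm⟩ = 1 then 1 else 0) := by
  obtain ⟨hℓ, hfirst, hlast⟩ := blockIndex_facts hm ha
  obtain ⟨C, hC, hCc⟩ := exists_strictMono_extension hm hc
  have hlam : ∀ i : Fin (∑ i, a i), blockSeq c a i = C (blockIndex a i) := fun i => by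
    rw [blockIndex, dif_pos i.2, hCc]
    rfl
  have hmn : m ≤ ∑ i, a i := by
    simpa using Finset.sum_le_sum (f := fun _ => 1) (g := a)
      fun i (_ : i ∈ Finset.univ) => ha i
  have hn : 2 ≤ ∑ i, a i := by
    rcases h_small with h | ⟨i, hi⟩
    · omega
    · have h1 := Finset.single_le_sum (f := a) (fun j _ => Nat.zero_le _) (Finset.mem_univ i)
      have h2 := ha i
      omega
  have hlast := hlast hn
  have hL : 2 ≤ m - 1 ∨ blockIndex a 1 = 0 ∨ blockIndex a (∑ i, a i - 2) = m - 1 := by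
    rw [hfirst, hlast]
    rcases h_small with h | ⟨i, hi⟩
    · exact .inl (by omega)
    · by_cases hi0 : (i : ℕ) = 0
      · rw [show i = ⟨0, hm⟩ from Fin.ext hi0] at hi
        exact .inr (.inl (.inr hi))
      · by_cases hi1 : (i : ℕ) = m - 1
        · rw [show i = ⟨m - 1, Nat.sub_one_lt_of_lt hm⟩ from Fin.ext hi1] at hi
          exact .inr (.inr (.inr hi))
        · exact .inl (by omega)
  obtain ⟨D, hD⟩ : ∃ D : ℕ, D + (if blockIndex a 1 = 0 then 0 else 1)
      + (if blockIndex a (∑ i, a i - 2) = m - 1 then 0 else 1) = 2 * (m - 1) := by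
    -- Truncated subtraction is harmless: both corrections vanish for `m = 1`, and otherwise `2 * (m
    -- - 1) ≥ 2`.
    refine ⟨2 * (m - 1) - (if blockIndex a 1 = 0 then 0 else 1)
      - (if blockIndex a (∑ i, a i - 2) = m - 1 then 0 else 1), ?_⟩
    by_cases h1 : m = 1
    · rw [if_pos (hfirst.2 (.inl h1)), if_pos (hlast.2 (.inl h1))]
      omega
    · split_ifs <;> omega
  have hup := edist_le hℓ hC hlam hn hL hD.ge
  obtain ⟨u, v, huv⟩ := exists_le_edist hℓ hC hlam hn hL hD.le
  have hediam : (oneSkeleton (gtPolytope (blockSeq c a))).ediam = D :=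
    le_antisymm (SimpleGraph.ediam_le_of_edist_le hup) (huv.trans SimpleGraph.edist_le_ediam)
  have htop : (oneSkeleton (gtPolytope (blockSeq c a))).ediam ≠ ⊤ := by
    rw [hediam]
    exact ENat.natCast_ne_top D
  have : Nonempty {v : TriangleIndex (∑ i, a i) → ℝ //
    IsExposed ℝ (gtPolytope (blockSeq c a)) {v}} := ⟨u⟩
  refine ⟨SimpleGraph.connected_of_ediam_ne_top htop, htop, ?_⟩
  rw [SimpleGraph.diam, hediam, ENat.toNat_natCast]
  -- For `m = 1` the first and last blocks coincide and `h_small` makes their multiplicity different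
  -- from 1.
  by_cases h1 : m = 1
  · subst h1
    have h2 : a ⟨0, hm⟩ ≠ 1 := by
      rcases h_small with h | ⟨i, hi⟩
      · omega
      · rwa [show i = ⟨0, hm⟩ from Fin.ext (by omega)] at hi
    rw [if_pos (hfirst.2 (.inl rfl)), if_pos (hlast.2 (.inl rfl))] at hD
    simp only [Nat.sub_self, h2, if_false]
    omega
  · simp only [hfirst, hlast, h1, false_or] at hD
    split_ifs at hD ⊢ <;> omega
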